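/- Let $E_8^7\subset\mathbb{R}^2$ be the lattice of all $(m_1,m_2)$ such that either $m_1,m_2\in\mathbb{Z}$ and $m_1+m_2$ is even, or $m_1,m_2\in\mathbb{Z}+\tfrac12$ and $m_1+m_2$ is odd, with norm $(m_1,m_2)^2=m_1^2+7m_2^2$. Let $L=E_8^7(-1)\oplus II_{1,1}$ be the Lorentzian lattice of vectors $(v,m,n)$ with $v\in E_8^7$, $m,n\in\mathbb{Z}$, and norm $(v,m,n)^2=-v^2-2mn$; write $(\cdot,\cdot)$ for the bilinear form. A root of $L$ is a primitive vector $\alpha\in L$ of negative norm whose reflection $x\mapsto x-\frac{2(x,\alpha)}{(\alpha,\alpha)}\alpha$ is an automorphism of $L$. The reflection group $W$ is the group generated by the reflections in all roots, and $\mathrm{Aut}(L)^+$ is the group of automorphisms of $L$ that map each of the two cones of positive norm vectors of $L\otimes\mathbb{R}$ to itself. A Weyl chamber is a connected component of the set of positive norm vectors of $L\otimes\mathbb{R}$ that lie on no hyperplane $\alpha^\perp$ ($\alpha$ a root). The simple roots of a Weyl chamber $D$ are the roots $\alpha$ that are positive on $D$ and for which $\alpha^\perp$ contains a codimension one face of $D$;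 a Weyl vector for $D$ is a vector $\rho$ with $(\rho,\alpha)=\alpha^2/2$ for all simple roots $\alpha$ of $D$. In the Dynkin diagram, two simple roots are joined by no line, a single, a double or a triple line if their hyperplanes meet at the angle $\pi/2,\pi/3,\pi/4,\pi/6$ in hyperbolic space, by a line labelled $\infty$ if the hyperplanes are parallel, and by a dashed line if they are ultraparallel. Then: 1. Every Weyl chamber of $L$ has exactly $6$ simple roots and has a Weyl vector in $L$ of norm $8$. 2. For a suitable Weyl chamber the simple roots are $$\begin{array}{ll}\alpha_1=((\tfrac12,\tfrac12),0,0), & \alpha_2=((\tfrac72,-\tfrac12),0,0),\\ \alpha_3=((0,0),1,1), & \alpha_4=((-\tfrac12,-\tfrac12),0,-1),\\ \alpha_5=((-2,0),1,-1), & \alpha_6=((-\tfrac72,\tfrac12),0,-7),\end{array}$$ where $\alpha_2,\alpha_6$ have norm $-14$ and $\alpha_1,\alpha_3,\alpha_4,\alpha_5$ have norm $-2$. The vector $\rho=((2,0),-2,3)$, of norm $8$, is a Weyl vector for this chamber, and $\alpha_1,\dots,\alpha_6$ are exactly the roots $\alpha$ of $L$ with $(\rho,\alpha)=\alpha^2/2$.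 3. $W$ is a subgroup of index $2$ in $\mathrm{Aut}(L)^+$. 4. The Dynkin diagram is a hexagon with the nodes in cyclic order $\alpha_5,\alpha_1,\alpha_4,\alpha_3,\alpha_6,\alpha_2$: the bonds $\alpha_5\alpha_1$ and $\alpha_4\alpha_3$ are single lines, $\alpha_1\alpha_4$ and $\alpha_6\alpha_2$ are labelled $\infty$, $\alpha_3\alpha_6$ and $\alpha_2\alpha_5$ are dashed, and all other pairs of nodes are not joined. -/

import Mathlib

/-! Lattices `L` in a real vector space `V = L ⊗ ℝ` with a symmetric bilinear form `B`;
the norm of `x` is `B x x`. -/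

namespace LorentzLattice

section General

variable {V : Type*} [AddCommGroup V] [Module ℝ V]

/-- `IsRoot B L α`: `α` is a root of the (not positive definite) lattice `L`, that is, a primitive
vector of negative norm such that the reflection `x ↦ x - 2 (x, α) / (α, α) α` is an automorphism
of `L`. (The reflection is an involutive isometry, so it suffices that it maps `L` into `L`.) -/
def IsRoot (B : LinearMap.BilinForm ℝ V) (L : Submodule ℤ V) (α : V) : Prop :=
  α ∈ L ∧ (∀ (n : ℤ) (β : V), β ∈ L → α = n • β → IsUnit n) ∧ B α α < 0 ∧
    ∀ x ∈ L, x - (2 * B x α / B α α) • α ∈ L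

/-- The automorphism group `Aut(L)`: the isometries of `V = L ⊗ ℝ` that map `L` onto itself. -/
def autGroup (B : LinearMap.BilinForm ℝ V) (L : Submodule ℤ V) : Subgroup (V ≃ₗ[ℝ] V) where
  carrier := {g | (∀ x y, B (g x) (g y) = B x y) ∧ ∀ x, g x ∈ L ↔ x ∈ L}
  one_mem' := ⟨fun _ _ => rfl, fun _ => Iff.rfl⟩
  mul_mem' := by
    rintro g h ⟨hg, hg'⟩ ⟨hh, hh'⟩
    exact ⟨fun x y => (hg _ _).trans (hh x y), fun x => (hg' _).trans (hh' x)⟩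
  inv_mem' := by
    rintro g ⟨hg, hg'⟩
    refine ⟨fun x y => ?_, fun x => ?_⟩
    · have h := hg (g⁻¹ x) (g⁻¹ y)
      rw [← h]
      congr 2
      · exact g.apply_symm_apply x
      · exact g.apply_symm_apply y
    · have h := hg' (g⁻¹ x)
      rw [← h]
      exact iff_of_eq (congrArg (· ∈ L) (g.apply_symm_apply x))

/-- The reflection group of `L`, generated by the reflections in all roots of `L`. -/
def reflectionGroup (B : LinearMap.BilinForm ℝ V) (L : Submodule ℤ V) : Subgroup (V ≃ₗ[ℝ] V) :=
  Subgroup.closure {s | ∃ α, IsRoot B L α ∧ ∀ x, s x = x - (2 * B x α / B α α) • α}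

/-- The possible bonds between two nodes of a Dynkin diagram. -/
inductive Bond
  /-- no line: the mirrors are perpendicular -/
  | absent
  /-- a single line: the mirrors meet at the angle `π / 3` -/
  | single
  /-- a double line: the mirrors meet at the angle `π / 4` -/
  | double
  /-- a triple line: the mirrors meet at the angle `π / 6` -/
  | triple
  /-- a line with label `∞`: the mirrors are parallel (they meet at infinity only) -/
  | infinite
  /-- a dashed line: the mirrors are ultraparallel (they do not meet, not even at infinity) -/
  | dashed

/-- `HasBond B α β b`: the nodes of two simple roots `α`, `β` (of negative norm) are joined by the
bond `b`. With `c = (α, β) / √(α² β²) ≥ 0`, the mirrors meet in hyperbolic space, at the dihedral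
angle `arccos c`, iff `c < 1`; they are parallel iff `c = 1` and ultraparallel iff `c > 1`. -/
def HasBond (B : LinearMap.BilinForm ℝ V) (α β : V) (b : Bond) : Prop :=
  0 ≤ B α β ∧
    match b with
    | .absent => B α β = 0
    | .single => B α β ^ 2 / (B α α * B β β) = 1 / 4
    | .double => B α β ^ 2 / (B α α * B β β) = 1 / 2
    | .triple => B α β ^ 2 / (B α α * B β β) = 3 / 4
    | .infinite => B α β ^ 2 / (B α α * B β β) = 1
    | .dashed => 1 < B α β ^ 2 / (B α α * B β β)

variable [TopologicalSpace V]

/-- `Aut(L)⁺`: the automorphisms of `L` that map each of the two cones of positive norm vectors,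
i.e. of the two path components of `{x | 0 < x²}`, to itself. -/
def autGroupPlus (B : LinearMap.BilinForm ℝ V) (L : Submodule ℤ V) : Subgroup (V ≃ₗ[ℝ] V) where
  carrier := {g | g ∈ autGroup B L ∧ ∀ x, 0 < B x x → JoinedIn {y | 0 < B y y} x (g x)}
  one_mem' := ⟨one_mem _, fun x hx => JoinedIn.refl hx⟩
  mul_mem' := by
    rintro g h ⟨hg, hg'⟩ ⟨hh, hh'⟩
    refine ⟨mul_mem hg hh, fun x hx => (hh' x hx).trans (hg' (h x) ?_)⟩
    rw [hh.1]
    exact hx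
  inv_mem' := by
    rintro g ⟨hg, hg'⟩
    have hi := inv_mem hg
    refine ⟨hi, fun x hx => ?_⟩
    have h := hg' (g⁻¹ x) (by rw [hi.1]; exact hx)
    have e : g (g⁻¹ x) = x := g.apply_symm_apply x
    rw [e] at h
    exact h.symm

/-- The vectors of positive norm that lie on no reflection hyperplane `α^⊥`, `α` a root of `L`. -/
def regularVectors (B : LinearMap.BilinForm ℝ V) (L : Submodule ℤ V) : Set V :=
  {x | 0 < B x x ∧ ∀ α, IsRoot B L α → B x α ≠ 0}

/-- The (open) Weyl chambers of the reflection group, as open convex cones of positive norm vectors: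
the connected components of the complement of the reflection hyperplanes. Intersecting with the
norm `1` vectors gives the chambers in hyperbolic space. -/
def IsWeylChamber (B : LinearMap.BilinForm ℝ V) (L : Submodule ℤ V) (D : Set V) : Prop :=
  ∃ x ∈ regularVectors B L, D = connectedComponentIn (regularVectors B L) x

/-- The simple roots of `L` belonging to the Weyl chamber `D`: the roots `α`, with sign chosen such
that `(x, α) > 0` on `D`, whose hyperplane `α^⊥` cuts out a face of `D` of codimension one. -/
def simpleRoots (B : LinearMap.BilinForm ℝ V) (L : Submodule ℤ V) (D : Set V) : Set V :=
  {α | IsRoot B L α ∧ (∀ x ∈ D, 0 < B x α) ∧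
    (Submodule.span ℝ {x | x ∈ closure D ∧ 0 < B x x ∧ B x α = 0} : Set V) = {x | B x α = 0}}

/-- `ρ` is a Weyl vector for the Weyl chamber `D`: `(ρ, α) = α² / 2` for all simple roots `α`. -/
def IsWeylVector (B : LinearMap.BilinForm ℝ V) (L : Submodule ℤ V) (D : Set V) (ρ : V) : Prop :=
  ∀ α ∈ simpleRoots B L D, B ρ α = B α α / 2

end General

/-- The lattice `E_8^7` in `ℝ²`: the vectors `(m₁, m₂)` with either `m₁, m₂ ∈ ℤ` and `m₁ + m₂` even
or `m₁, m₂ ∈ ℤ + 1/2` and `m₁ + m₂` odd. -/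
def latticeE87 : Submodule ℤ (ℝ × ℝ) where
  carrier := {v | (∃ a b : ℤ, v = ((a : ℝ), (b : ℝ)) ∧ Even (a + b)) ∨
    ∃ a b : ℤ, v = ((a : ℝ) + 1 / 2, (b : ℝ) + 1 / 2) ∧ Odd (a + b + 1)}
  zero_mem' := Or.inl ⟨0, 0, by ext <;> simp, by simp⟩
  add_mem' := by
    rintro v w (⟨a, b, rfl, h⟩ | ⟨a, b, rfl, h⟩) (⟨c, d, rfl, k⟩ | ⟨c, d, rfl, k⟩)
    · refine Or.inl ⟨a + c, b + d, by simp, by grind⟩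
    · refine Or.inr ⟨a + c, b + d, ?_, by grind⟩
      ext <;> push_cast <;> simp <;> ring
    · refine Or.inr ⟨a + c, b + d, ?_, by grind⟩
      ext <;> push_cast <;> simp <;> ring
    · refine Or.inl ⟨a + c + 1, b + d + 1, ?_, by grind⟩
      ext <;> push_cast <;> simp <;> ring
  smul_mem' := by
    rintro n v (⟨a, b, rfl, h⟩ | ⟨a, b, rfl, h⟩)
    · refine Or.inl ⟨n * a, n * b, by simp, ?_⟩
      rw [← mul_add]
      exact h.mul_left n
    · rcases Int.even_or_odd' n with ⟨k, rfl | rfl⟩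
      · refine Or.inl ⟨2 * k * a + k, 2 * k * b + k, ?_, by grind⟩
        ext <;> simp <;> ring
      · refine Or.inr ⟨(2 * k + 1) * a + k, (2 * k + 1) * b + k, ?_, ?_⟩
        · ext <;> simp <;> ring
        · obtain ⟨j, hj⟩ := h
          exact ⟨2 * k * j + k + j, by linear_combination (2 * k + 1) * hj⟩

/-- The lattice `II_{1,1}`: the vectors `(m, n) ∈ ℤ²`. -/
def latticeII11 : Submodule ℤ (ℝ × ℝ) where
  carrier := {v | ∃ m n : ℤ, v = ((m : ℝ), (n : ℝ))}
  zero_mem' := ⟨0, 0, by ext <;> simp⟩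
  add_mem' := by
    rintro v w ⟨a, b, rfl⟩ ⟨c, d, rfl⟩
    exact ⟨a + c, b + d, by simp⟩
  smul_mem' := by
    rintro n v ⟨a, b, rfl⟩
    exact ⟨n * a, n * b, by simp⟩

/-- The underlying lattice of `L = E_8^7(-1) ⊕ II_{1,1}`, with elements `(r, m, n)`. -/
def latticeL : Submodule ℤ ((ℝ × ℝ) × (ℝ × ℝ)) :=
  latticeE87.prod latticeII11

/-- The bilinear form of `L = E_8^7(-1) ⊕ II_{1,1}`: the norm of `(r, m, n)` is
`-(r₁² + 7 r₂²) - 2 m n`. -/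
noncomputable def formL : LinearMap.BilinForm ℝ ((ℝ × ℝ) × (ℝ × ℝ)) :=
  LinearMap.mk₂ ℝ
    (fun x y => -(x.1.1 * y.1.1 + 7 * (x.1.2 * y.1.2)) - (x.2.1 * y.2.2 + x.2.2 * y.2.1))
    (by intros; simp; ring) (by intros; simp; ring) (by intros; simp; ring) (by intros; simp; ring)

/-- The six listed simple roots `α₁, …, α₆` of `L` (indexed from `0`). -/
noncomputable def listedRoot : Fin 6 → (ℝ × ℝ) × (ℝ × ℝ) :=
  ![((1 / 2, 1 / 2), (0, 0)),
    ((7 / 2, -1 / 2), (0, 0)),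
    ((0, 0), (1, 1)),
    ((-1 / 2, -1 / 2), (0, -1)),
    ((-2, 0), (1, -1)),
    ((-7 / 2, 1 / 2), (0, -7))]

/-- The Weyl vector `ρ = (r, -2, 3)` with `r = (2, 0)`. -/
def listedWeylVector : (ℝ × ℝ) × (ℝ × ℝ) := ((2, 0), (-2, 3))

/-- The Dynkin diagram of `L`, with nodes `α₁, …, α₆`: the hexagon
`α₅ — α₁ —∞— α₄ — α₃ - - α₆ —∞— α₂ - - α₅`, where `- -` is a dashed line. Diagonal entries carry no
information. -/
def dynkinDiagramL : Matrix (Fin 6) (Fin 6) Bond :=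
  !![.absent, .absent, .absent, .infinite, .single, .absent;
     .absent, .absent, .absent, .absent, .dashed, .infinite;
     .absent, .absent, .absent, .single, .absent, .dashed;
     .infinite, .absent, .single, .absent, .absent, .absent;
     .single, .dashed, .absent, .absent, .absent, .absent;
     .absent, .infinite, .dashed, .absent, .absent, .absent]

end LorentzLattice

namespace LorentzLattice

/-! The proof takes `w = chamberPoint`, the negative of the Weyl vector, as base point of the cone
on which all six listed roots are positive, and shows by descent that every root positive at `w` is
a combination of listed roots with nonnegative coefficients.

Since `L` is even of determinant ±7, roots have norm `-2d` with `d = 1` or `d = 7`, and all their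
products with `L` are divisible by `d`. Three facts drive the descent. The norm is a polynomial with
nonnegative coefficients in the products with the listed roots (`cone_identity`), so a root, having
negative norm, is negative on some listed root. No root is orthogonal to `w`
(`formL_chamberPoint_ne_zero`). The only root positive at `w` and negative at `w + αᵢ`, the mirror
image of `w`, is `αᵢ` (`eq_of_separated`). Hence reflecting an unlisted positive root in a suitable
`αᵢ` gives a smaller positive root (`exists_smaller_root`). It follows that the cone is a Weyl
chamber and that its simple roots are the listed ones.

Minimising `(x, g w)` over the orbit of `w` moves every chamber in the cone of `w` to this one by an
element of `W`; `-1` exchanges the cones. So `Aut(L)⁺` is generated by `W` and the automorphisms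
permuting the listed roots, namely the identity and `diagramAut`. The latter is not in `W`: `L / 2L`
is a sum of two anisotropic planes, each preserved by every root reflection, and `diagramAut`
exchanges them. -/

theorem formL_apply (x y : (ℝ × ℝ) × (ℝ × ℝ)) : formL x y =
    -(x.1.1 * y.1.1 + 7 * (x.1.2 * y.1.2)) - (x.2.1 * y.2.2 + x.2.2 * y.2.1) := rfl

theorem formL_comm (x y : (ℝ × ℝ) × (ℝ × ℝ)) : formL x y = formL y x := by
  simp only [formL_apply]; ring

/-! ### Integral coordinates and Lorentzian signature -/

/-- The vector of `L` with coordinates `(i, j, m, n)` with respect to a `ℤ`-basis of `L`. -/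
noncomputable def latVec (i j m n : ℤ) : (ℝ × ℝ) × (ℝ × ℝ) :=
  (((i : ℝ) / 2 + 2 * j, (i : ℝ) / 2), ((m : ℝ), (n : ℝ)))

theorem mem_latticeL_iff {x : (ℝ × ℝ) × (ℝ × ℝ)} :
    x ∈ latticeL ↔ ∃ i j m n : ℤ, x = latVec i j m n := by
  obtain ⟨⟨a, b⟩, m, n⟩ := x
  constructor
  · rintro ⟨h, m, n, hmn⟩
    obtain ⟨rfl, rfl⟩ := Prod.mk.inj hmn
    rcases h with ⟨a, b, hab, c, hc⟩ | ⟨a, b, hab, c, hc⟩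
    · obtain ⟨rfl, rfl⟩ := Prod.mk.inj hab
      refine ⟨2 * b, c - b, m, n, ?_⟩
      have : a = 2 * c - b - b + b := by omega
      ext <;> simp [latVec, this]
      ring
    · obtain ⟨rfl, rfl⟩ := Prod.mk.inj hab
      refine ⟨2 * b + 1, c - b, m, n, ?_⟩
      have : a = 2 * c - b := by omega
      ext <;> simp [latVec, this] <;> ring
  · rintro ⟨i, j, m', n', h⟩
    rw [h]
    refine ⟨?_, m', n', rfl⟩
    rcases Int.even_or_odd' i with ⟨k, rfl | rfl⟩
    · refine Or.inl ⟨k + 2 * j, k, ?_, k + j, by ring⟩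
      ext <;> simp [latVec]
    · refine Or.inr ⟨k + 2 * j, k, ?_, k + j, by ring⟩
      ext <;> simp [latVec] <;> ring

theorem latVec_mem (i j m n : ℤ) : latVec i j m n ∈ latticeL :=
  mem_latticeL_iff.2 ⟨i, j, m, n, rfl⟩

theorem formL_latVec (i j m n i' j' m' n' : ℤ) :
    formL (latVec i j m n) (latVec i' j' m' n') =
      ((-(2 * i * i' + i * j' + j * i' + 4 * j * j') - m * n' - n * m' : ℤ) : ℝ) := by
  simp only [formL_apply, latVec]
  push_cast
  ring

theorem exists_int_formL {x y : (ℝ × ℝ) × (ℝ × ℝ)} (hx : x ∈ latticeL) (hy : y ∈ latticeL) :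
    ∃ k : ℤ, formL x y = k := by
  obtain ⟨i, j, m, n, rfl⟩ := mem_latticeL_iff.1 hx
  obtain ⟨i', j', m', n', rfl⟩ := mem_latticeL_iff.1 hy
  exact ⟨_, formL_latVec ..⟩

theorem exists_even_norm {x : (ℝ × ℝ) × (ℝ × ℝ)} (hx : x ∈ latticeL) :
    ∃ k : ℤ, formL x x = 2 * k := by
  obtain ⟨i, j, m, n, rfl⟩ := mem_latticeL_iff.1 hx
  refine ⟨-(i * i + i * j + 2 * j * j) - m * n, ?_⟩
  rw [formL_latVec]
  push_cast
  ring

theorem eq_zero_of_formL {x : (ℝ × ℝ) × (ℝ × ℝ)} (h : ∀ y, formL x y = 0) : x = 0 := by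
  have h1 := h ((1, 0), (0, 0))
  have h2 := h ((0, 1), (0, 0))
  have h3 := h ((0, 0), (1, 0))
  have h4 := h ((0, 0), (0, 1))
  simp only [formL_apply] at h1 h2 h3 h4
  ext <;> simp <;> linarith

/-- Vectors orthogonal to a vector of positive norm have norm at most `0`, and `0` only if they
vanish. -/
theorem norm_neg_of_orthogonal {x y : (ℝ × ℝ) × (ℝ × ℝ)} (hx : 0 < formL x x)
    (hxy : formL x y = 0) : formL y y ≤ 0 ∧ (formL y y = 0 → y = 0) := by
  obtain ⟨⟨a, b⟩, m, n⟩ := x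
  obtain ⟨⟨a', b'⟩, m', n'⟩ := y
  simp only [formL_apply] at *
  -- Twice the norm is `t² - (s² + 2a² + 14b²)`, with `t` the only positive direction; the claim is
  -- then Cauchy–Schwarz in the negative directions.
  set t := m - n with ht
  set s := m + n with hs
  set t' := m' - n' with ht'
  set s' := m' + n' with hs'
  have e1 : t * t' = s * s' + 2 * (a * a' + 7 * (b * b')) := by
    rw [ht, hs, ht', hs']; linarith
  have e2 : s * s + 2 * (a * a + 7 * (b * b)) < t * t := by
    rw [ht, hs]; linarith
  have e3 : -(a' * a' + 7 * (b' * b')) - (m' * n' + n' * m')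
      = (t' * t' - (s' * s' + 2 * (a' * a' + 7 * (b' * b')))) / 2 := by
    rw [ht', hs']; ring
  have cs : (t * t') ^ 2 ≤ (s * s + 2 * (a * a + 7 * (b * b))) *
      (s' * s' + 2 * (a' * a' + 7 * (b' * b'))) := by
    rw [e1]
    nlinarith [sq_nonneg (s * a' - s' * a), sq_nonneg (s * b' - s' * b),
      sq_nonneg (a * b' - a' * b)]
  have hr : 0 ≤ s * s + 2 * (a * a + 7 * (b * b)) := by
    linarith [mul_self_nonneg s, mul_self_nonneg a, mul_self_nonneg b]
  have hr' : 0 ≤ s' * s' + 2 * (a' * a' + 7 * (b' * b')) := by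
    linarith [mul_self_nonneg s', mul_self_nonneg a', mul_self_nonneg b']
  have htt : 0 < t * t := lt_of_le_of_lt hr e2
  rw [e3]
  have key : (t * t) * (t' * t') ≤ (t * t) * (s' * s' + 2 * (a' * a' + 7 * (b' * b'))) := by
    calc (t * t) * (t' * t') = (t * t') ^ 2 := by ring
      _ ≤ _ := cs
      _ ≤ _ := mul_le_mul_of_nonneg_right e2.le hr'
  have hle := le_of_mul_le_mul_left key htt
  refine ⟨by linarith, fun h0 => ?_⟩
  have e4 : t' * t' = s' * s' + 2 * (a' * a' + 7 * (b' * b')) := by linarith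
  have e5 : s' * s' + 2 * (a' * a' + 7 * (b' * b')) = 0 := by
    by_contra hne
    have hpos := lt_of_le_of_ne hr' (Ne.symm hne)
    have h1 := mul_lt_mul_of_pos_right e2 hpos
    rw [← e4] at h1
    rw [← e4] at cs
    linarith [show (t * t') ^ 2 = t * t * (t' * t') by ring]
  have ha : a' = 0 := mul_self_eq_zero.1 (le_antisymm (by
    linarith [mul_self_nonneg s', mul_self_nonneg a', mul_self_nonneg b']) (mul_self_nonneg _))
  have hb : b' = 0 := mul_self_eq_zero.1 (le_antisymm (by
    linarith [mul_self_nonneg s', mul_self_nonneg a', mul_self_nonneg b']) (mul_self_nonneg _))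
  have hs0 : s' = 0 := mul_self_eq_zero.1 (le_antisymm (by
    linarith [mul_self_nonneg s', mul_self_nonneg a', mul_self_nonneg b']) (mul_self_nonneg _))
  have ht0 : t' = 0 := by rw [e5] at e4; exact mul_self_eq_zero.1 e4
  ext <;> simp <;> linarith

/-! ### Roots of `L` -/

/-- A rational multiple of a primitive lattice vector is in the lattice only if the coefficient is
an integer. -/
theorem dvd_of_rat_smul_mem {V : Type*} [AddCommGroup V] [Module ℝ V] {L : Submodule ℤ V}
    {α : V} (hα : α ∈ L) (hprim : ∀ (n : ℤ) (β : V), β ∈ L → α = n • β → IsUnit n)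
    {p q : ℤ} (hq : q ≠ 0) (h : ((p : ℝ) / q) • α ∈ L) : q ∣ p := by
  obtain ⟨g, hg, p', q', hcop, rfl, rfl⟩ : ∃ g : ℤ, g ≠ 0 ∧ ∃ p' q' : ℤ, IsCoprime p' q' ∧
      p = p' * g ∧ q = q' * g := by
    have hg : 0 < Int.gcd p q := Int.gcd_pos_of_ne_zero_right _ hq
    obtain ⟨p', q', hc, h1, h2⟩ := Int.exists_gcd_one hg
    exact ⟨_, by exact_mod_cast hg.ne', p', q', Int.isCoprime_iff_gcd_eq_one.2 hc, h1, h2⟩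
  have hq' : q' ≠ 0 := left_ne_zero_of_mul hq
  have hqR : (q' : ℝ) ≠ 0 := by exact_mod_cast hq'
  have hgR : (g : ℝ) ≠ 0 := by exact_mod_cast hg
  obtain ⟨u, v, huv⟩ := hcop
  have huvR : (u : ℝ) * p' + v * q' = 1 := by exact_mod_cast huv
  -- Bézout: `u p' + v q' = 1` turns `(p'/q') α` and `α` into `α / q'`, and primitivity makes `q'` a
  -- unit.
  have hmem : (1 / (q' : ℝ)) • α ∈ L := by
    have h1 := L.add_mem (L.smul_mem u h) (L.smul_mem v hα)
    convert h1 using 1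
    rw [← Int.cast_smul_eq_zsmul ℝ u, ← Int.cast_smul_eq_zsmul ℝ v, smul_smul, ← add_smul]
    congr 1
    push_cast
    field_simp
    linarith
  have hu := hprim q' _ hmem (by
    rw [← Int.cast_smul_eq_zsmul ℝ q', smul_smul, mul_one_div_cancel hqR, one_smul])
  exact mul_dvd_mul_right (hu.dvd) g

/-- With `β² = 2e`, the reflection moves `x` by `((x, β) / e) β`, so primitivity gives `e ∣ (x, β)`:
`β / e` lies in the dual lattice. Seven times the dual lattice is in `L`, so `(7 / e) β ∈ L` and,
again by primitivity, `e ∣ 7`. -/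
theorem root_cases {β : (ℝ × ℝ) × (ℝ × ℝ)} (h : IsRoot formL latticeL β) :
    ∃ d : ℤ, (d = 1 ∨ d = 7) ∧ formL β β = -2 * d ∧
      ∀ x ∈ latticeL, ∃ k : ℤ, formL x β = d * k := by
  obtain ⟨hmem, hprim, hneg, hrefl⟩ := h
  obtain ⟨e, he⟩ := exists_even_norm hmem
  have he0 : (e : ℝ) < 0 := by linarith
  have he0' : e ≠ 0 := by rintro rfl; simp at he0
  have hdvd : ∀ x ∈ latticeL, ∃ k : ℤ, formL x β = e * k := by
    intro x hx
    obtain ⟨p, hp⟩ := exists_int_formL hx hmem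
    have h1 := latticeL.sub_mem hx (hrefl x hx)
    rw [sub_sub_cancel, he, hp, mul_div_mul_left _ _ two_ne_zero] at h1
    obtain ⟨k, rfl⟩ := dvd_of_rat_smul_mem hmem hprim he0' h1
    exact ⟨k, by rw [hp]; push_cast; ring⟩
  have h7 : e ∣ 7 := by
    refine dvd_of_rat_smul_mem hmem hprim he0' ?_
    obtain ⟨k1, h1⟩ := hdvd _ (latVec_mem 1 0 0 0)
    obtain ⟨k2, h2⟩ := hdvd _ (latVec_mem 0 1 0 0)
    obtain ⟨k3, h3⟩ := hdvd _ (latVec_mem 0 0 1 0)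
    obtain ⟨k4, h4⟩ := hdvd _ (latVec_mem 0 0 0 1)
    obtain ⟨i, j, m, n, rfl⟩ := mem_latticeL_iff.1 hmem
    rw [formL_latVec] at h1 h2 h3 h4
    push_cast at h1 h2 h3 h4
    have heR : (e : ℝ) ≠ 0 := he0.ne
    rw [mem_latticeL_iff]
    -- Coordinates of `7β / e`, obtained with the inverse `(1/7) [[4, -1], [-1, 2]]` of the Gram
    -- matrix `[[2, 1], [1, 4]]` of `E_8^7`.
    refine ⟨-4 * k1 + k2, k1 - 2 * k2, -7 * k4, -7 * k3, ?_⟩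
    ext <;> simp [latVec] <;> field_simp <;> linarith
  have h7' : -e ∣ 7 := (neg_dvd).2 h7
  have hle := Int.le_of_dvd (by norm_num) h7'
  have hpos : 0 < -e := by
    have : e < 0 := by exact_mod_cast he0
    omega
  refine ⟨-e, ?_, ?_, fun x hx => ?_⟩
  · clear * - hle hpos h7'
    generalize -e = f at *
    interval_cases f <;> revert h7' <;> decide
  · rw [he]; push_cast; ring
  · obtain ⟨k, hk⟩ := hdvd x hx
    exact ⟨-k, by rw [hk]; push_cast; ring⟩

/-- Primitivity comes for free: `L` is even, so `β = nγ` forces `n² ∣ d`. -/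
theorem isRoot_of_norm {β : (ℝ × ℝ) × (ℝ × ℝ)} (hβ : β ∈ latticeL) {d : ℤ} (hd : d = 1 ∨ d = 7)
    (hn : formL β β = -2 * d) (hdvd : ∀ x ∈ latticeL, ∃ k : ℤ, formL x β = d * k) :
    IsRoot formL latticeL β := by
  have hdR : (0 : ℝ) < d := by rcases hd with rfl | rfl <;> norm_num
  refine ⟨hβ, fun n γ hγ hnγ => ?_, by linarith, fun x hx => ?_⟩
  · obtain ⟨k, hk⟩ := exists_even_norm hγ
    rw [hnγ, ← Int.cast_smul_eq_zsmul ℝ n] at hn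
    simp only [map_smul, LinearMap.smul_apply, smul_eq_mul, hk] at hn
    have h1 : n * n * (-k) = d := by
      have : (n : ℝ) * n * (-k) = d := by linarith
      exact_mod_cast this
    have hnn : n * n ∣ 7 := (Dvd.intro _ h1).trans (by rcases hd with rfl | rfl <;> decide)
    have h2 : n * n ≤ 7 := Int.le_of_dvd (by norm_num) hnn
    have h3 : -2 ≤ n := by nlinarith
    have h4 : n ≤ 2 := by nlinarith
    clear * - hnn h3 h4
    rw [Int.isUnit_iff]
    interval_cases n <;> revert hnn <;> decide
  · obtain ⟨k, hk⟩ := hdvd x hx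
    have : 2 * formL x β / formL β β = ((-k : ℤ) : ℝ) := by
      rw [hk, hn]; push_cast; field_simp
    rw [this, Int.cast_smul_eq_zsmul]
    exact latticeL.sub_mem hx (latticeL.smul_mem _ hβ)

/-! ### Reflections as automorphisms -/

section General

variable {V : Type*} [AddCommGroup V] [Module ℝ V] {B : LinearMap.BilinForm ℝ V}
  {L : Submodule ℤ V}

theorem IsRoot.map {g : V ≃ₗ[ℝ] V} (hg : g ∈ autGroup B L) {α : V} (h : IsRoot B L α) :
    IsRoot B L (g α) := by
  obtain ⟨hmem, hprim, hneg, hrefl⟩ := h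
  refine ⟨(hg.2 α).2 hmem, fun n β hβ hn => ?_, by rwa [hg.1], fun x hx => ?_⟩
  · have hi := (hg.2 (g.symm β)).1 (by rwa [g.apply_symm_apply])
    refine hprim n _ hi (g.injective ?_)
    rw [hn, map_zsmul, g.apply_symm_apply]
  · obtain ⟨y, rfl⟩ := g.surjective x
    rw [hg.1, hg.1, ← map_smul, ← map_sub, hg.2]
    exact hrefl y ((hg.2 y).1 hx)

/-- The reflection in the hyperplane orthogonal to a vector of nonzero norm. -/
noncomputable def reflectionEquiv (B : LinearMap.BilinForm ℝ V) (α : V) (h : B α α ≠ 0) :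
    V ≃ₗ[ℝ] V :=
  LinearEquiv.ofInvolutive
    (LinearMap.id - (LinearMap.toSpanSingleton ℝ V α).comp ((2 / B α α) • B.flip α)) (by
    intro x
    change x - (2 / B α α * B x α) • α - (2 / B α α * B (x - (2 / B α α * B x α) • α) α) • α = x
    rw [sub_sub, ← add_smul, sub_eq_self]
    convert zero_smul ℝ α
    simp only [map_sub, map_smul, LinearMap.sub_apply, LinearMap.smul_apply, smul_eq_mul]
    field_simp
    ring)

theorem reflectionEquiv_apply (α : V) (h : B α α ≠ 0) (x : V) :
    reflectionEquiv B α h x = x - (2 * B x α / B α α) • α := by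
  rw [mul_div_right_comm]
  rfl

theorem reflectionEquiv_mem_autGroup (hB : ∀ x y, B x y = B y x) {α : V} (hα : IsRoot B L α) :
    reflectionEquiv B α hα.2.2.1.ne ∈ autGroup B L := by
  have h0 : B α α ≠ 0 := hα.2.2.1.ne
  have hinv : ∀ x, reflectionEquiv B α h0 (reflectionEquiv B α h0 x) = x := fun x =>
    (reflectionEquiv B α h0).symm_apply_apply x
  have hL : ∀ x ∈ L, reflectionEquiv B α h0 x ∈ L := fun x hx => by
    rw [reflectionEquiv_apply]
    exact hα.2.2.2 x hx
  refine ⟨fun x y => ?_, fun x => ⟨fun h => ?_, hL x⟩⟩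
  · simp only [reflectionEquiv_apply, map_sub, map_smul, LinearMap.sub_apply,
      LinearMap.smul_apply, smul_eq_mul, hB α y]
    field_simp
    ring
  · rw [← hinv x]
    exact hL _ h

theorem reflectionEquiv_mem_reflectionGroup {α : V} (hα : IsRoot B L α) :
    reflectionEquiv B α hα.2.2.1.ne ∈ reflectionGroup B L :=
  Subgroup.subset_closure ⟨α, hα, reflectionEquiv_apply α _⟩

end General

/-! ### The Weyl vector and the cone of the listed roots -/

/-- The negative of the Weyl vector, a point in the interior of the fundamental chamber. -/
def chamberPoint : (ℝ × ℝ) × (ℝ × ℝ) := -listedWeylVector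

theorem chamberPoint_eq : chamberPoint = latVec 0 (-1) 2 (-3) := by
  ext <;> simp [chamberPoint, listedWeylVector, latVec]

theorem chamberPoint_mem : chamberPoint ∈ latticeL := chamberPoint_eq ▸ latVec_mem ..

theorem chamberPoint_norm : formL chamberPoint chamberPoint = 8 := by
  rw [chamberPoint_eq, formL_latVec]; norm_num

theorem listedRoot_eq (i : Fin 6) : listedRoot i = ![latVec 1 0 0 0, latVec (-1) 2 0 0,
    latVec 0 0 1 1, latVec (-1) 0 0 (-1), latVec 0 (-1) 1 (-1), latVec 1 (-2) 0 (-7)] i := by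
  fin_cases i <;> ext <;> simp [listedRoot, latVec] <;> norm_num

theorem formL_listedRoot_self (i : Fin 6) : formL (listedRoot i) (listedRoot i) =
    (![-2, -14, -2, -2, -2, -14] : Fin 6 → ℝ) i := by
  fin_cases i <;> simp [listedRoot, formL_apply] <;> norm_num

theorem formL_chamberPoint_listedRoot (i : Fin 6) :
    formL chamberPoint (listedRoot i) = -formL (listedRoot i) (listedRoot i) / 2 := by
  fin_cases i <;> simp [listedRoot, chamberPoint, listedWeylVector, formL_apply] <;> norm_num

theorem isRoot_listedRoot (i : Fin 6) : IsRoot formL latticeL (listedRoot i) := by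
  have hmem : listedRoot i ∈ latticeL := by
    rw [listedRoot_eq]; fin_cases i <;> exact latVec_mem ..
  have h1 : formL (listedRoot i) (listedRoot i) = -2 → IsRoot formL latticeL (listedRoot i) :=
    fun h => isRoot_of_norm hmem (d := 1) (Or.inl rfl) (by rw [h]; norm_num)
      fun x hx => by simpa using exists_int_formL hx hmem
  have h7 : formL (listedRoot i) (listedRoot i) = -14 →
      (∀ x ∈ latticeL, ∃ k : ℤ, formL x (listedRoot i) = 7 * k) →
      IsRoot formL latticeL (listedRoot i) :=
    fun h h' => isRoot_of_norm hmem (d := 7) (Or.inr rfl) (by rw [h]; norm_num)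
      (by simpa using h')
  have hn := formL_listedRoot_self i
  fin_cases i
  · exact h1 hn
  · refine h7 hn fun x hx => ?_
    obtain ⟨a, b, m, n, rfl⟩ := mem_latticeL_iff.1 hx
    refine ⟨-b, ?_⟩
    rw [listedRoot_eq]
    refine (formL_latVec ..).trans ?_
    push_cast
    ring
  · exact h1 hn
  · exact h1 hn
  · exact h1 hn
  · refine h7 hn fun x hx => ?_
    obtain ⟨a, b, m, n, rfl⟩ := mem_latticeL_iff.1 hx
    refine ⟨b + m, ?_⟩
    rw [listedRoot_eq]
    refine (formL_latVec ..).trans ?_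
    push_cast
    ring

/-- All coefficients are nonnegative, which certifies that the cone cut out by the listed roots lies
in the closed cone of nonnegative norm. -/
theorem cone_identity (y : (ℝ × ℝ) × (ℝ × ℝ)) : formL y y =
    (formL y (listedRoot 0) + formL y (listedRoot 3)) *
      (formL y (listedRoot 2) + formL y (listedRoot 4)) +
    formL y (listedRoot 0) * formL y (listedRoot 3) / 2 +
    formL y (listedRoot 1) * formL y (listedRoot 5) / 14 := by
  simp [listedRoot, formL_apply]
  ring

theorem norm_nonneg_of_cone {y : (ℝ × ℝ) × (ℝ × ℝ)} (h : ∀ i, 0 ≤ formL y (listedRoot i)) :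
    0 ≤ formL y y := by
  have h0 := h 0
  have h1 := h 1
  have h2 := h 2
  have h3 := h 3
  have h4 := h 4
  have h5 := h 5
  rw [cone_identity]
  positivity

theorem norm_pos_of_cone {y : (ℝ × ℝ) × (ℝ × ℝ)} (h : ∀ i, 0 < formL y (listedRoot i)) :
    0 < formL y y := by
  have h0 := h 0
  have h1 := h 1
  have h2 := h 2
  have h3 := h 3
  have h4 := h 4
  have h5 := h 5
  rw [cone_identity]
  positivity

/-! ### Descent on positive roots -/

/-- No root is orthogonal to the Weyl vector. -/
theorem formL_chamberPoint_ne_zero {β : (ℝ × ℝ) × (ℝ × ℝ)} (hβ : IsRoot formL latticeL β) :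
    formL chamberPoint β ≠ 0 := by
  intro h
  obtain ⟨d, hd, hn, hdvd⟩ := root_cases hβ
  obtain ⟨k3, h3⟩ := hdvd _ (latVec_mem 0 0 1 0)
  obtain ⟨k4, h4⟩ := hdvd _ (latVec_mem 0 0 0 1)
  obtain ⟨i, j, m, n, rfl⟩ := mem_latticeL_iff.1 hβ.1
  rw [chamberPoint_eq, formL_latVec] at h
  rw [formL_latVec] at hn h3 h4
  have hn' : -(2 * i * i + i * j + j * i + 4 * j * j) - m * n - n * m = -2 * d := by
    exact_mod_cast hn
  have h' : i = 2 * n - 3 * m - 4 * j := by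
    have := Int.cast_eq_zero.1 h
    linarith
  have h3' : n = d * (-k3) := by
    have : -(n : ℝ) = d * k3 := by rw [← h3]; push_cast; ring
    have : -n = d * k3 := by exact_mod_cast this
    linarith
  have h4' : m = d * (-k4) := by
    have : -(m : ℝ) = d * k4 := by rw [← h4]; push_cast; ring
    have : -m = d * k4 := by exact_mod_cast this
    linarith
  -- This is `-4` times the norm equation with `j` eliminated, a sum of squares because the
  -- complement of the Weyl vector is negative definite. Finitely many triples remain; for `d = 7`
  -- divisibility by `7` kills `m` and `n`, leaving `i² = 8`.
  have key : 7 * (i * i) + (2 * n - m) * (2 * n - m) + 8 * (m * m) = 8 * d := by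
    linear_combination (-4) * hn' - (i + 4 * j + 2 * n - 3 * m) * h'
  have hi := mul_self_nonneg i
  have hnm := mul_self_nonneg (2 * n - m)
  have hm := mul_self_nonneg m
  clear * - h3' h4' key hi hnm hm hd
  rcases hd with rfl | rfl
  · have h1 : -1 ≤ m := by nlinarith
    have h2 : m ≤ 1 := by nlinarith
    have h3 : -1 ≤ i := by nlinarith
    have h4 : i ≤ 1 := by nlinarith
    have h5 : -2 ≤ n := by nlinarith
    have h6 : n ≤ 2 := by nlinarith
    interval_cases m <;> interval_cases i <;> interval_cases n <;> omega
  · have hm0 : m = 0 := by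
      have h1 : -2 ≤ m := by nlinarith
      have h2 : m ≤ 2 := by nlinarith
      omega
    subst hm0
    have hn0 : n = 0 := by
      have h1 : -3 ≤ n := by nlinarith
      have h2 : n ≤ 3 := by nlinarith
      omega
    subst hn0
    have h1 : -3 < i := by nlinarith
    have h2 : i < 3 := by nlinarith
    interval_cases i <;> omega

/-- A root cannot separate `w` and its mirror image under the reflection of a simple root `α`,
unless it is `α`. -/
theorem eq_of_separated {α β : (ℝ × ℝ) × (ℝ × ℝ)} (hα : IsRoot formL latticeL α)
    (hβ : IsRoot formL latticeL β) (hw : formL chamberPoint α = -formL α α / 2)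
    (hp : 0 < formL chamberPoint β) (hq : formL chamberPoint β + formL α β < 0) : β = α := by
  obtain ⟨d, hd, hαn, hαd⟩ := root_cases hα
  obtain ⟨e, he, hβn, hβd⟩ := root_cases hβ
  obtain ⟨p, hp'⟩ := hβd _ chamberPoint_mem
  obtain ⟨q, hq'⟩ := hβd _ hα.1
  obtain ⟨r, hr'⟩ := hαd _ hβ.1
  have hwα : formL chamberPoint α = d := by rw [hw, hαn]; ring
  have hαw : formL α chamberPoint = d := by rw [formL_comm, hwα]
  have hβw : formL β chamberPoint = e * p := by rw [formL_comm, hp']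
  have hβα : formL β α = e * q := by rw [formL_comm, hq']
  -- The component of `β` orthogonal to both `chamberPoint` and `α`, scaled by `d (d + 16)`, which
  -- is minus their Gram determinant. Its norm cannot be positive, which bounds `p` and `q`.
  set y := ((d : ℝ) * (d + 16)) • β - ((2 * d * e * p + d * e * q : ℝ)) • chamberPoint -
    ((d * e * p - 8 * e * q : ℝ)) • α with hy
  have hyw : formL chamberPoint y = 0 := by
    simp only [hy, map_sub, map_smul, smul_eq_mul, hwα, hp', chamberPoint_norm]
    ring
  have hyy : formL y y = ((d : ℝ) * (d + 16)) *
      (8 * e ^ 2 * q ^ 2 - 2 * d * e ^ 2 * p * q - 2 * d * e ^ 2 * p ^ 2 -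
        2 * e * (d * (d + 16))) := by
    simp only [hy, map_sub, map_smul, smul_eq_mul, LinearMap.sub_apply, LinearMap.smul_apply, hwα,
      hαw, hβw, hβα, hαn, hβn, hq', hp', chamberPoint_norm]
    ring
  obtain ⟨hle, heq⟩ := norm_neg_of_orthogonal (by rw [chamberPoint_norm]; norm_num) hyw
  rw [hβα] at hr'
  rw [hp'] at hp hq
  rw [hq'] at hq
  rw [hyy] at hle heq
  have hr : e * q = d * r := by exact_mod_cast hr'
  have hp0 : 0 < e * p := by exact_mod_cast hp
  have hq0 : e * p + e * q < 0 := by exact_mod_cast hq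
  have hle' : d * (d + 16) * (8 * e ^ 2 * q ^ 2 - 2 * d * e ^ 2 * p * q - 2 * d * e ^ 2 * p ^ 2 -
        2 * e * (d * (d + 16))) ≤ 0 := by exact_mod_cast hle
  have h3 : e = d ∧ p = 1 ∧ q = -2 := by
    clear * - hd he hr hp0 hq0 hle'
    -- With `p, u ≥ 1` the bound reads `4e (p + u)² + d e p u ≤ d (d + 16)`. For `d = e` it forces
    -- `p = u = 1`. For `d = 1`, `e = 7` it fails at once, and for `d = 7`, `e = 1` because then `7
    -- ∣ p + u`.
    obtain ⟨u, rfl⟩ : ∃ u, q = -(p + u) := ⟨-q - p, by ring⟩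
    rcases hd with rfl | rfl <;> rcases he with rfl | rfl
    · have hp1 : 1 ≤ p := by omega
      have hu1 : 1 ≤ u := by omega
      have hp2 : p < 2 := by nlinarith
      have hu2 : u < 2 := by nlinarith
      omega
    · have hp1 : 1 ≤ p := by omega
      have hu1 : 1 ≤ u := by omega
      nlinarith
    · have hp1 : 1 ≤ p := by omega
      have hu1 : 1 ≤ u := by omega
      have hr1 : 7 ≤ p + u := by omega
      nlinarith [mul_le_mul hr1 hr1 (by norm_num) (by omega),
        mul_le_mul hp1 hu1 (by norm_num) (by omega)]
    · have hp1 : 1 ≤ p := by omega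
      have hu1 : 1 ≤ u := by omega
      have hp2 : p < 2 := by nlinarith
      have hu2 : u < 2 := by nlinarith
      omega
  obtain ⟨rfl, rfl, rfl⟩ := h3
  -- In the surviving case the norm of `y` is `0`, so `y` vanishes by definiteness.
  have hy0 : y = 0 := heq (by rcases hd with rfl | rfl <;> norm_num)
  have hc : ((e : ℝ) * (e + 16)) ≠ 0 := by rcases hd with rfl | rfl <;> norm_num
  have hz : ((e : ℝ) * (e + 16)) • (β - α) = 0 := by
    rw [← hy0, hy, smul_sub]
    push_cast
    rw [show (2 * e * e * 1 + e * e * -2 : ℝ) = 0 by ring, zero_smul, sub_zero]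
    congr 2
    rcases hd with rfl | rfl <;> norm_num
  exact sub_eq_zero.1 ((smul_eq_zero.1 hz).resolve_left hc)

/-- A positive root that is not one of the listed roots is the sum of a smaller positive root of the
same norm and a positive multiple of a listed root. -/
theorem exists_smaller_root {β : (ℝ × ℝ) × (ℝ × ℝ)} (hβ : IsRoot formL latticeL β)
    (hpos : 0 < formL chamberPoint β) (hne : β ∉ Set.range listedRoot) :
    ∃ (i : Fin 6) (k : ℝ) (γ : (ℝ × ℝ) × (ℝ × ℝ)), 1 ≤ k ∧ IsRoot formL latticeL γ ∧
      β = γ + k • listedRoot i ∧ formL γ γ = formL β β ∧ 0 < formL chamberPoint γ := by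
  obtain ⟨i, hi⟩ : ∃ i, formL β (listedRoot i) < 0 := by
    by_contra! h
    exact absurd (norm_nonneg_of_cone h) (not_le.2 hβ.2.2.1)
  have hα := isRoot_listedRoot i
  obtain ⟨d, hd, hn, hdvd⟩ := root_cases hα
  obtain ⟨r, hr⟩ := hdvd _ hβ.1
  have hdR : (0 : ℝ) < d := by rcases hd with rfl | rfl <;> norm_num
  have hs := reflectionEquiv_mem_autGroup formL_comm hα
  have hsβ := reflectionEquiv_apply _ hα.2.2.1.ne β
  have hk : 2 * formL β (listedRoot i) / formL (listedRoot i) (listedRoot i) = -r := by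
    rw [hr, hn]; field_simp
  rw [hk] at hsβ
  have hγ := hβ.map hs
  have hγn := hs.1 β β
  have hw := formL_chamberPoint_listedRoot i
  have hr1 : (1 : ℝ) ≤ -r := by
    have h1 : (d : ℝ) * r < 0 := hr ▸ hi
    have h2 : (r : ℝ) < 0 := by by_contra! h; exact absurd (mul_nonneg hdR.le h) (not_le.2 h1)
    have h3 : r < 0 := by exact_mod_cast h2
    have h4 : 1 ≤ -r := by omega
    exact_mod_cast h4
  rw [hsβ] at hγ hγn
  refine ⟨i, -r, _, hr1, hγ, by rw [sub_add_cancel], hγn, ?_⟩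
  -- The product of `chamberPoint` with `γ = sᵢ β` is that of `chamberPoint + αᵢ` with `β`; were it
  -- negative, `β` would separate the two points and equal `αᵢ`.
  refine lt_of_le_of_ne (not_lt.1 fun hlt => hne ⟨i, ?_⟩) (formL_chamberPoint_ne_zero hγ).symm
  refine (eq_of_separated hα hβ hw hpos ?_).symm
  rw [formL_comm (listedRoot i), hr]
  simp only [map_sub, map_smul, smul_eq_mul, hw, hn] at hlt
  linarith

/-- The product with `chamberPoint` is a positive integer that strictly drops in each descent step.
-/
theorem posRoot_induction {P : (ℝ × ℝ) × (ℝ × ℝ) → Prop} (base : ∀ i, P (listedRoot i))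
    (step : ∀ (i : Fin 6) (k : ℝ) γ, 1 ≤ k → P γ → P (γ + k • listedRoot i))
    {β : (ℝ × ℝ) × (ℝ × ℝ)} (hβ : IsRoot formL latticeL β) (hpos : 0 < formL chamberPoint β) :
    P β := by
  obtain ⟨n, hn⟩ : ∃ n : ℕ, formL chamberPoint β = n := by
    obtain ⟨k, hk⟩ := exists_int_formL chamberPoint_mem hβ.1
    rw [hk] at hpos
    have hk0 : 0 < k := by exact_mod_cast hpos
    exact ⟨k.toNat, by rw [hk, ← Int.cast_natCast, Int.toNat_of_nonneg hk0.le]⟩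
  induction n using Nat.strong_induction_on generalizing β with
  | _ n ih =>
    by_cases hmem : β ∈ Set.range listedRoot
    · obtain ⟨i, rfl⟩ := hmem
      exact base i
    · obtain ⟨i, k, γ, hk, hγ, rfl, -, hγpos⟩ := exists_smaller_root hβ hpos hmem
      obtain ⟨m, hm⟩ := exists_int_formL chamberPoint_mem hγ.1
      have hm0 : 0 < m := by rw [hm] at hγpos; exact_mod_cast hγpos
      have hm' : formL chamberPoint γ = (m.toNat : ℝ) := by
        rw [hm, ← Int.cast_natCast, Int.toNat_of_nonneg hm0.le]
      refine step i k γ hk (ih m.toNat ?_ hγ hγpos hm')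
      have hα : 0 < formL chamberPoint (listedRoot i) := by
        rw [formL_chamberPoint_listedRoot]
        linarith [(isRoot_listedRoot i).2.2.1]
      rw [map_add, map_smul, smul_eq_mul, hm'] at hn
      have : (m.toNat : ℝ) < n := by
        rw [← hn]
        have := mul_pos (lt_of_lt_of_le one_pos hk) hα
        linarith
      exact_mod_cast this

theorem formL_root_pos {β x : (ℝ × ℝ) × (ℝ × ℝ)} (hβ : IsRoot formL latticeL β)
    (hpos : 0 < formL chamberPoint β) (hx : ∀ i, 0 < formL x (listedRoot i)) :
    0 < formL x β := by
  refine posRoot_induction (P := fun β => 0 < formL x β) hx (fun i k γ hk hγ => ?_) hβ hpos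
  have := mul_pos (lt_of_lt_of_le one_pos hk) (hx i)
  rw [map_add, map_smul, smul_eq_mul]
  linarith

theorem formL_root_nonneg {β x : (ℝ × ℝ) × (ℝ × ℝ)} (hβ : IsRoot formL latticeL β)
    (hpos : 0 < formL chamberPoint β) (hx : ∀ i, 0 ≤ formL x (listedRoot i)) :
    0 ≤ formL x β := by
  refine posRoot_induction (P := fun β => 0 ≤ formL x β) hx (fun i k γ hk hγ => ?_) hβ hpos
  have := mul_nonneg (zero_le_one.trans hk) (hx i)
  rw [map_add, map_smul, smul_eq_mul]
  linarith

/-- An unlisted positive root `β` of norm `-2d` is `γ + k αᵢ` with `γ` positive of the same norm.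
The product of `chamberPoint` with `γ` is a positive multiple of `d`, so its product with `β`
exceeds `d`. -/
theorem range_listedRoot_eq : Set.range listedRoot = {α | IsRoot formL latticeL α ∧
    formL listedWeylVector α = formL α α / 2} := by
  have hρ : ∀ α, formL listedWeylVector α = -formL chamberPoint α := fun α => by
    simp [chamberPoint]
  ext β
  constructor
  · rintro ⟨i, rfl⟩
    refine ⟨isRoot_listedRoot i, ?_⟩
    rw [hρ, formL_chamberPoint_listedRoot]
    ring
  · rintro ⟨hβ, hw⟩
    by_contra hmem
    have hneg := hβ.2.2.1
    rw [hρ] at hw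
    obtain ⟨i, k, γ, hk, hγ, rfl, hn, hγpos⟩ := exists_smaller_root hβ (by linarith) hmem
    obtain ⟨d, hd, hγn, hγd⟩ := root_cases hγ
    obtain ⟨r, hr⟩ := hγd _ chamberPoint_mem
    have hα : 0 < formL chamberPoint (listedRoot i) := by
      rw [formL_chamberPoint_listedRoot]
      linarith [(isRoot_listedRoot i).2.2.1]
    have hpos := mul_pos (lt_of_lt_of_le one_pos hk) hα
    have hdR : (0 : ℝ) < d := by rcases hd with rfl | rfl <;> norm_num
    rw [← hn, hγn, map_add, map_smul, smul_eq_mul, hr] at hw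
    rw [hr] at hγpos
    have hr0 : (0 : ℝ) < r := by
      by_contra! h
      exact absurd (mul_nonpos_of_nonneg_of_nonpos hdR.le h) (not_le.2 hγpos)
    have hr1 : (1 : ℝ) ≤ r := by
      have : 0 < r := by exact_mod_cast hr0
      exact_mod_cast this
    nlinarith

/-- Proportional roots on the same side of the Weyl vector are equal. -/
theorem root_eq_of_smul {α β : (ℝ × ℝ) × (ℝ × ℝ)} (hα : IsRoot formL latticeL α)
    (hβ : IsRoot formL latticeL β) (hαpos : 0 < formL chamberPoint α)
    (hβpos : 0 < formL chamberPoint β) {c : ℝ} (h : α = c • β) : α = β := by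
  obtain ⟨d, hd, hαn, hαd⟩ := root_cases hα
  obtain ⟨e, he, hβn, hβd⟩ := root_cases hβ
  obtain ⟨p, hp⟩ := hαd _ chamberPoint_mem
  obtain ⟨q, hq⟩ := hβd _ chamberPoint_mem
  have h1 : d * p = c * (e * q) := by
    rw [← hp, ← hq, h, map_smul, smul_eq_mul]
  have h2 : (d : ℝ) = c ^ 2 * e := by
    have : formL α α = c ^ 2 * formL β β := by
      rw [h]; simp only [map_smul, LinearMap.smul_apply, smul_eq_mul]; ring
    rw [hαn, hβn] at this
    linarith
  have heR : (0 : ℝ) < e := by rcases he with rfl | rfl <;> norm_num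
  have hdR : (0 : ℝ) < d := by rcases hd with rfl | rfl <;> norm_num
  rw [hp] at hαpos
  rw [hq] at hβpos
  have hq0 : q ≠ 0 := by rintro rfl; simp at hβpos
  have h3 : d * (p * p) = e * (q * q) := by
    have : (d : ℝ) * (d * (p * p)) = d * (e * (q * q)) := by
      calc (d : ℝ) * (d * (p * p)) = (d * p) * (d * p) := by ring
        _ = (c ^ 2 * e) * (e * (q * q)) := by rw [h1]; ring
        _ = _ := by rw [← h2]
    exact_mod_cast mul_left_cancel₀ hdR.ne' this
  -- Proportional roots of different norms would make `7` the square of a rational number.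
  have h4 : d = e := by
    have hp7 : ∀ a b : ℤ, b ≠ 0 → a * a ≠ 7 * (b * b) := by
      intro a b hb hab
      have hirr : Irrational (√(7 : ℕ)) := Nat.Prime.irrational_sqrt (by norm_num)
      refine hirr ⟨|(a : ℚ)| / |(b : ℚ)|, ?_⟩
      rw [eq_comm, Real.sqrt_eq_iff_mul_self_eq (by positivity) (by positivity)]
      have hbR : (b : ℝ) ≠ 0 := by exact_mod_cast hb
      have habR : (a : ℝ) * a = 7 * (b * b) := by exact_mod_cast hab
      push_cast
      rw [div_mul_div_comm, abs_mul_abs_self, abs_mul_abs_self, habR]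
      field_simp
    have hp0 : p ≠ 0 := by rintro rfl; simp at hαpos
    rcases hd with rfl | rfl <;> rcases he with rfl | rfl
    · rfl
    · exact absurd (by linarith) (hp7 p q hq0)
    · exact absurd (by linarith) (hp7 q p hp0)
    · rfl
  subst h4
  have hc : c ^ 2 = 1 := by
    have : (d : ℝ) * (c ^ 2) = d * 1 := by linarith
    exact mul_left_cancel₀ hdR.ne' this
  rcases mul_self_eq_one_iff.1 ((sq c).symm.trans hc) with rfl | rfl
  · rw [h, one_smul]
  · linarith

/-! ### The fundamental chamber, its closure and its faces -/

theorem continuous_formL {T : Type*} [TopologicalSpace T] {f g : T → (ℝ × ℝ) × (ℝ × ℝ)}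
    (hf : Continuous f) (hg : Continuous g) : Continuous fun x => formL (f x) (g x) := by
  simp only [formL_apply]
  fun_prop

/-- The Weyl chamber cut out by the listed roots. -/
def fundamentalChamber : Set ((ℝ × ℝ) × (ℝ × ℝ)) :=
  {x | ∀ i, 0 < formL x (listedRoot i)}

theorem formL_chamberPoint_listedRoot_pos (i : Fin 6) :
    0 < formL chamberPoint (listedRoot i) := by
  rw [formL_chamberPoint_listedRoot]
  linarith [(isRoot_listedRoot i).2.2.1]

theorem chamberPoint_mem_fundamentalChamber : chamberPoint ∈ fundamentalChamber :=
  formL_chamberPoint_listedRoot_pos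

theorem convex_fundamentalChamber : Convex ℝ fundamentalChamber := by
  intro x hx y hy a b ha hb hab i
  simp only [map_add, map_smul, LinearMap.add_apply, LinearMap.smul_apply, smul_eq_mul]
  rcases ha.eq_or_lt with rfl | ha
  · rw [zero_add] at hab
    simpa [hab] using hy i
  · exact add_pos_of_pos_of_nonneg (mul_pos ha (hx i)) (mul_nonneg hb (hy i).le)

theorem fundamentalChamber_subset : fundamentalChamber ⊆ regularVectors formL latticeL := by
  intro x hx
  refine ⟨norm_pos_of_cone hx, fun α hα => ?_⟩
  rcases (formL_chamberPoint_ne_zero hα).lt_or_gt with h | h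
  · have hα' : IsRoot formL latticeL (-α) := by
      have hneg : LinearEquiv.neg ℝ ∈ autGroup formL latticeL :=
        ⟨fun x y => by simp, fun x => by simp⟩
      exact hα.map hneg
    have := formL_root_pos hα' (by simpa using h) hx
    rw [map_neg] at this
    linarith
  · exact (formL_root_pos hα h hx).ne'

/-- The cone is convex, hence connected. Regular vectors outside it are strictly negative on some
listed root, which is an open condition, so the component cannot leave the cone. -/
theorem connectedComponentIn_eq_fundamentalChamber {x : (ℝ × ℝ) × (ℝ × ℝ)}
    (hx : x ∈ fundamentalChamber) :
    connectedComponentIn (regularVectors formL latticeL) x = fundamentalChamber := by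
  refine Set.Subset.antisymm ?_
    (convex_fundamentalChamber.isPreconnected.subset_connectedComponentIn hx
      fundamentalChamber_subset)
  have hcont : ∀ i, Continuous fun x => formL x (listedRoot i) := fun i =>
    continuous_formL continuous_id continuous_const
  have ho : IsOpen fundamentalChamber := by
    simp only [fundamentalChamber, Set.ofPred_forall]
    exact isOpen_iInter_of_finite fun i => isOpen_lt continuous_const (hcont i)
  have hu : IsOpen {x | ∃ i, formL x (listedRoot i) < 0} := by
    rw [Set.ofPred_exists]
    exact isOpen_iUnion fun i => isOpen_lt (hcont i) continuous_const
  refine isPreconnected_connectedComponentIn.subset_left_of_subset_union ho hu ?_ ?_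
    ⟨x, mem_connectedComponentIn (fundamentalChamber_subset hx), hx⟩
  · rw [Set.disjoint_left]
    rintro y hy ⟨i, hi⟩
    exact absurd (hy i) (not_lt.2 hi.le)
  · intro y hy
    have hreg := connectedComponentIn_subset _ _ hy
    by_cases h : ∃ i, formL y (listedRoot i) < 0
    · exact Or.inr h
    · push Not at h
      exact Or.inl fun i => lt_of_le_of_ne (h i) (hreg.2 _ (isRoot_listedRoot i)).symm

theorem isWeylChamber_fundamentalChamber : IsWeylChamber formL latticeL fundamentalChamber :=
  ⟨chamberPoint, fundamentalChamber_subset chamberPoint_mem_fundamentalChamber,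
    (connectedComponentIn_eq_fundamentalChamber chamberPoint_mem_fundamentalChamber).symm⟩

theorem mem_closure_fundamentalChamber {x : (ℝ × ℝ) × (ℝ × ℝ)} :
    x ∈ closure fundamentalChamber ↔ ∀ i, 0 ≤ formL x (listedRoot i) := by
  constructor
  · intro hx i
    refine closure_minimal (t := {x | 0 ≤ formL x (listedRoot i)}) (fun y hy => (hy i).le)
      (isClosed_le continuous_const (continuous_formL continuous_id continuous_const)) hx
  · intro hx
    have ht : Filter.Tendsto (fun n : ℕ => x + (1 / ((n : ℝ) + 1)) • chamberPoint) Filter.atTop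
        (nhds (x + (0 : ℝ) • chamberPoint)) :=
      (tendsto_one_div_add_atTop_nhds_zero_nat.smul_const _).const_add _
    rw [zero_smul, add_zero] at ht
    refine mem_closure_of_tendsto ht (Filter.Eventually.of_forall fun n i => ?_)
    simp only [map_add, map_smul, LinearMap.add_apply, LinearMap.smul_apply, smul_eq_mul]
    exact add_pos_of_nonneg_of_pos (hx i)
      (mul_pos (by positivity) (formL_chamberPoint_listedRoot_pos i))

theorem formL_listedRoot_nonneg {i j : Fin 6} (h : i ≠ j) :
    0 ≤ formL (listedRoot i) (listedRoot j) := by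
  rw [listedRoot_eq, listedRoot_eq]
  revert h
  fin_cases i <;> fin_cases j <;>
    simp [formL_latVec]

theorem span_face_eq (i : Fin 6) :
    (Submodule.span ℝ {x | x ∈ closure fundamentalChamber ∧ 0 < formL x x ∧
      formL x (listedRoot i) = 0} : Set ((ℝ × ℝ) × (ℝ × ℝ))) =
      {x | formL x (listedRoot i) = 0} := by
  set S := {x | x ∈ closure fundamentalChamber ∧ 0 < formL x x ∧ formL x (listedRoot i) = 0}
  apply Set.Subset.antisymm
  · have : Submodule.span ℝ S ≤ LinearMap.ker (formL.flip (listedRoot i)) :=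
      Submodule.span_le.2 fun x hx => hx.2.2
    exact fun x hx => this hx
  · intro y hy
    -- The sum of `chamberPoint` and its mirror image `chamberPoint + αᵢ`: a relative interior point
    -- of the face. A small segment from it in any direction `y` of the mirror stays in the face, so
    -- `y` is in the span.
    set x₀ := (2 : ℝ) • chamberPoint + listedRoot i with hx₀
    have hα := (isRoot_listedRoot i).2.2.1
    have hx₀i : formL x₀ (listedRoot i) = 0 := by
      simp only [hx₀, map_add, map_smul, LinearMap.add_apply, LinearMap.smul_apply, smul_eq_mul,
        formL_chamberPoint_listedRoot]
      ring
    have hx₀j : ∀ j, j ≠ i → 0 < formL x₀ (listedRoot j) := fun j hj => by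
      simp only [hx₀, map_add, map_smul, LinearMap.add_apply, LinearMap.smul_apply, smul_eq_mul]
      have h1 := formL_chamberPoint_listedRoot_pos j
      have h2 := formL_listedRoot_nonneg hj.symm
      linarith
    have hx₀n : 0 < formL x₀ x₀ := by
      simp only [hx₀, map_add, map_smul, LinearMap.add_apply, LinearMap.smul_apply, smul_eq_mul,
        formL_comm _ chamberPoint, chamberPoint_norm, formL_chamberPoint_listedRoot]
      linarith
    have hline : Continuous fun t : ℝ => x₀ + t • y := by fun_prop
    have c1 : ∀ j, Continuous fun t : ℝ => formL (x₀ + t • y) (listedRoot j) := fun j =>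
      continuous_formL hline continuous_const
    have c2 : Continuous fun t : ℝ => formL (x₀ + t • y) (x₀ + t • y) :=
      continuous_formL hline hline
    have hev : ∀ᶠ t : ℝ in nhds 0, (∀ j, j ≠ i → 0 < formL (x₀ + t • y) (listedRoot j)) ∧
        0 < formL (x₀ + t • y) (x₀ + t • y) := by
      refine (Filter.eventually_all.2 fun j => ?_).and ?_
      · by_cases hj : j = i
        · exact Filter.Eventually.of_forall fun t h => absurd hj h
        · have := (c1 j).tendsto' 0 (formL x₀ (listedRoot j)) (by simp)
          exact (this.eventually_const_lt (hx₀j j hj)).mono fun t ht _ => ht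
      · exact (c2.tendsto' 0 (formL x₀ x₀) (by simp)).eventually_const_lt hx₀n
    obtain ⟨ε, hε, hball⟩ := Metric.eventually_nhds_iff.1 hev
    have hy' : formL y (listedRoot i) = 0 := hy
    have hmem : ∀ t : ℝ, |t| < ε → x₀ + t • y ∈ S := fun t ht => by
      obtain ⟨h1, h2⟩ := hball (y := t) (by simpa using ht)
      have h3 : formL (x₀ + t • y) (listedRoot i) = 0 := by
        simp only [map_add, map_smul, LinearMap.add_apply, LinearMap.smul_apply, hx₀i, hy',
          smul_zero, add_zero]
      refine ⟨mem_closure_fundamentalChamber.2 fun j => ?_, h2, h3⟩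
      by_cases hj : j = i
      · rw [hj, h3]
      · exact (h1 j hj).le
    have m0 := Submodule.subset_span (R := ℝ) (hmem 0 (by simpa using hε))
    have m1 := Submodule.subset_span (R := ℝ)
      (hmem (ε / 2) (by rw [abs_of_pos (by positivity)]; linarith))
    have m2 := Submodule.smul_mem _ (2 / ε) (Submodule.sub_mem _ m1 m0)
    rw [zero_smul, add_zero, add_sub_cancel_left, smul_smul, div_mul_div_comm, mul_comm ε,
      div_self (by positivity), one_smul] at m2
    exact m2

/-- If `β = γ + k αᵢ` is unlisted, both summands are nonnegative on the closed chamber, so its face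
in `β^⊥` lies in `αᵢ^⊥`. If that face spans `β^⊥`, then `αᵢ` is proportional to `β`, hence equal to
it. -/
theorem simpleRoots_fundamentalChamber :
    simpleRoots formL latticeL fundamentalChamber = Set.range listedRoot := by
  apply Set.Subset.antisymm
  · rintro β ⟨hβ, hpos, hspan⟩
    by_contra hmem
    have hwβ := hpos _ chamberPoint_mem_fundamentalChamber
    obtain ⟨i, k, γ, hk, hγ, hβγ, -, hγpos⟩ := exists_smaller_root hβ hwβ hmem
    have hle : Submodule.span ℝ {x | x ∈ closure fundamentalChamber ∧ 0 < formL x x ∧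
        formL x β = 0} ≤ LinearMap.ker (formL.flip (listedRoot i)) := by
      refine Submodule.span_le.2 fun x hx => ?_
      have hx1 := mem_closure_fundamentalChamber.1 hx.1
      have h1 := formL_root_nonneg hγ hγpos hx1
      have h2 := hx.2.2
      rw [hβγ, map_add, map_smul, smul_eq_mul] at h2
      have h3 : k * formL x (listedRoot i) = 0 :=
        le_antisymm (by linarith) (mul_nonneg (by linarith) (hx1 i))
      exact (mul_eq_zero.1 h3).resolve_left (by linarith)
    have horth : ∀ x, formL x β = 0 → formL x (listedRoot i) = 0 := fun x hx => by
      have : x ∈ (Submodule.span ℝ {x | x ∈ closure fundamentalChamber ∧ 0 < formL x x ∧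
        formL x β = 0} : Set ((ℝ × ℝ) × (ℝ × ℝ))) := by rw [hspan]; exact hx
      exact hle this
    have hβ0 : formL β β ≠ 0 := hβ.2.2.1.ne
    have hprop : listedRoot i = (formL β (listedRoot i) / formL β β) • β := by
      rw [← sub_eq_zero]
      refine eq_zero_of_formL fun x => ?_
      have h := horth (x - (formL x β / formL β β) • β) (by
        simp only [map_sub, map_smul, LinearMap.sub_apply, LinearMap.smul_apply, smul_eq_mul]
        field_simp
        ring)
      simp only [map_sub, map_smul, LinearMap.sub_apply, LinearMap.smul_apply, smul_eq_mul] at h ⊢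
      rw [formL_comm (listedRoot i) x, formL_comm β x]
      linear_combination h
    exact hmem ⟨i, root_eq_of_smul (isRoot_listedRoot i) hβ
      (formL_chamberPoint_listedRoot_pos i) hwβ hprop⟩
  · rintro _ ⟨i, rfl⟩
    exact ⟨isRoot_listedRoot i, fun x hx => hx i, span_face_eq i⟩

/-! ### The two cones of positive norm vectors -/

theorem formL_chamberPoint_ne_zero_of_norm_pos {x : (ℝ × ℝ) × (ℝ × ℝ)} (hx : 0 < formL x x) :
    formL chamberPoint x ≠ 0 := fun h =>
  absurd (norm_neg_of_orthogonal (by rw [chamberPoint_norm]; norm_num) h).1 (not_le.2 hx)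

/-- Otherwise the positive combination of `x` and `-y` orthogonal to `chamberPoint` would have
positive norm. -/
theorem formL_pos_of_same_cone {x y : (ℝ × ℝ) × (ℝ × ℝ)} (hx : 0 < formL x x)
    (hy : 0 < formL y y) (hwx : 0 < formL chamberPoint x) (hwy : 0 < formL chamberPoint y) :
    0 < formL x y := by
  by_contra! h
  set z := formL chamberPoint y • x - formL chamberPoint x • y with hz
  have hwz : formL chamberPoint z = 0 := by
    simp only [hz, map_sub, map_smul, smul_eq_mul]
    ring
  have hzz : formL z z = formL chamberPoint y ^ 2 * formL x x +
      formL chamberPoint x ^ 2 * formL y y +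
      2 * (formL chamberPoint x * formL chamberPoint y) * (-formL x y) := by
    simp only [hz, map_sub, map_smul, smul_eq_mul, LinearMap.sub_apply, LinearMap.smul_apply,
      formL_comm y x]
    ring
  have h1 := (norm_neg_of_orthogonal (by rw [chamberPoint_norm]; norm_num) hwz).1
  have h2 : 0 < formL z z := by
    rw [hzz]
    have : 0 ≤ -formL x y := by linarith
    positivity
  linarith

theorem joinedIn_of_same_cone {x y : (ℝ × ℝ) × (ℝ × ℝ)} (hx : 0 < formL x x)
    (hy : 0 < formL y y) (hxy : 0 < formL x y) : JoinedIn {z | 0 < formL z z} x y := by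
  refine JoinedIn.of_segment_subset ?_
  rintro _ ⟨a, b, ha, hb, hab, rfl⟩
  have : formL (a • x + b • y) (a • x + b • y) =
      a ^ 2 * formL x x + b ^ 2 * formL y y + 2 * (a * b) * formL x y := by
    simp only [map_add, map_smul, smul_eq_mul, LinearMap.add_apply, LinearMap.smul_apply,
      formL_comm y x]
    ring
  rw [Set.mem_ofPred_eq, this]
  rcases ha.eq_or_lt with rfl | ha
  · rw [zero_add] at hab
    simpa [hab] using hy
  · positivity

/-- The product with `chamberPoint` has no zero among vectors of positive norm, so its sign is
constant along a path. -/
theorem formL_chamberPoint_pos_of_joinedIn {x y : (ℝ × ℝ) × (ℝ × ℝ)}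
    (h : JoinedIn {z | 0 < formL z z} x y) (hx : 0 < formL chamberPoint x) :
    0 < formL chamberPoint y := by
  obtain ⟨γ, hγ⟩ := h
  have hc : Continuous fun t => formL chamberPoint (γ t) :=
    continuous_formL continuous_const γ.continuous
  by_contra! hy
  obtain ⟨t, ht⟩ := mem_range_of_exists_le_of_exists_ge hc ⟨1, by simpa using hy⟩
    ⟨0, by simpa using hx.le⟩
  exact formL_chamberPoint_ne_zero_of_norm_pos (hγ t) ht

/-- For a reflection, `(x, s x) = x² - 2 (x, α)² / α² > 0` as `α² < 0`, so the segment from `x` to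
`s x` keeps positive norm. -/
theorem reflectionGroup_le_autGroupPlus :
    reflectionGroup formL latticeL ≤ autGroupPlus formL latticeL := by
  refine (Subgroup.closure_le _).2 ?_
  rintro s ⟨α, hα, hs⟩
  have hs' : s = reflectionEquiv formL α hα.2.2.1.ne := by
    ext x : 1
    rw [hs, reflectionEquiv_apply]
  have haut : s ∈ autGroup formL latticeL := hs' ▸ reflectionEquiv_mem_autGroup formL_comm hα
  refine ⟨haut, fun x hx => joinedIn_of_same_cone hx (by rwa [haut.1]) ?_⟩
  have hneg := hα.2.2.1
  have h0 : -(2 / formL α α) ≥ 0 := by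
    have := div_nonpos_of_nonneg_of_nonpos (zero_le_two (α := ℝ)) hneg.le
    linarith
  have : formL x (s x) = formL x x + -(2 / formL α α) * formL x α ^ 2 := by
    rw [hs, map_sub, map_smul, smul_eq_mul]
    ring
  rw [this]
  positivity

/-! ### Automorphisms and Weyl chambers -/

section Transport

variable {g : ((ℝ × ℝ) × (ℝ × ℝ)) ≃ₗ[ℝ] ((ℝ × ℝ) × (ℝ × ℝ))}

theorem map_mem_regularVectors (hg : g ∈ autGroup formL latticeL) {x : (ℝ × ℝ) × (ℝ × ℝ)}
    (hx : x ∈ regularVectors formL latticeL) : g x ∈ regularVectors formL latticeL := by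
  refine ⟨by rw [hg.1]; exact hx.1, fun α hα => ?_⟩
  have h := hx.2 _ (hα.map (inv_mem hg))
  rwa [← hg.1, show g (g⁻¹ α) = α from g.apply_symm_apply α] at h

theorem image_regularVectors (hg : g ∈ autGroup formL latticeL) :
    g '' regularVectors formL latticeL = regularVectors formL latticeL := by
  apply Set.Subset.antisymm
  · rintro _ ⟨x, hx, rfl⟩
    exact map_mem_regularVectors hg hx
  · exact fun x hx => ⟨_, map_mem_regularVectors (inv_mem hg) hx, g.apply_symm_apply x⟩

theorem image_connectedComponentIn_regularVectors (hg : g ∈ autGroup formL latticeL)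
    {x : (ℝ × ℝ) × (ℝ × ℝ)} (hx : x ∈ regularVectors formL latticeL) :
    g '' connectedComponentIn (regularVectors formL latticeL) x =
      connectedComponentIn (regularVectors formL latticeL) (g x) := by
  have h := g.toContinuousLinearEquiv.toHomeomorph.image_connectedComponentIn hx
  refine h.trans ?_
  congr 1
  exact image_regularVectors hg

theorem map_mem_simpleRoots (hg : g ∈ autGroup formL latticeL) {D : Set ((ℝ × ℝ) × (ℝ × ℝ))}
    {α : (ℝ × ℝ) × (ℝ × ℝ)} (hα : α ∈ simpleRoots formL latticeL D) :
    g α ∈ simpleRoots formL latticeL (g '' D) := by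
  obtain ⟨hroot, hpos, hspan⟩ := hα
  refine ⟨hroot.map hg, ?_, ?_⟩
  · rintro _ ⟨x, hx, rfl⟩
    rw [hg.1]
    exact hpos x hx
  · have hcl : closure (g '' D) = g '' closure D :=
      (g.toContinuousLinearEquiv.toHomeomorph.image_closure D).symm
    have hset : {x | x ∈ closure (g '' D) ∧ 0 < formL x x ∧ formL x (g α) = 0} =
        (g : _ →ₗ[ℝ] _) '' {x | x ∈ closure D ∧ 0 < formL x x ∧ formL x α = 0} := by
      rw [hcl]
      ext y
      constructor
      · rintro ⟨⟨x, hx, rfl⟩, h1, h2⟩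
        rw [hg.1] at h1 h2
        exact ⟨x, ⟨hx, h1, h2⟩, rfl⟩
      · rintro ⟨x, ⟨hx, h1, h2⟩, rfl⟩
        refine ⟨⟨x, hx, rfl⟩, ?_, ?_⟩
        · exact (hg.1 x x).symm ▸ h1
        · exact (hg.1 x α).trans h2
    rw [hset, Submodule.span_image, Submodule.map_coe, hspan]
    ext y
    constructor
    · rintro ⟨x, hx, rfl⟩
      exact (hg.1 x α).trans hx
    · intro hy
      refine ⟨g.symm y, ?_, g.apply_symm_apply y⟩
      rw [Set.mem_ofPred_eq, ← hg.1, g.apply_symm_apply]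
      exact hy

theorem simpleRoots_image (hg : g ∈ autGroup formL latticeL) (D : Set ((ℝ × ℝ) × (ℝ × ℝ))) :
    simpleRoots formL latticeL (g '' D) = g '' simpleRoots formL latticeL D := by
  apply Set.Subset.antisymm
  · intro α hα
    have h := map_mem_simpleRoots (inv_mem hg) hα
    have hD : (g⁻¹ : _ ≃ₗ[ℝ] _) '' (g '' D) = D := by
      rw [Set.image_image]
      exact (Set.image_congr fun x _ => g.symm_apply_apply x).trans (Set.image_id' D)
    rw [hD] at h
    exact ⟨_, h, g.apply_symm_apply α⟩
  · rintro _ ⟨α, hα, rfl⟩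
    exact map_mem_simpleRoots hg hα

end Transport

/-! ### Every chamber is conjugate to the fundamental chamber -/

/-- For small `ε > 0` the vector `x - εe` is still in the cone, so `ε (e, y) < (x, y) ≤ c`. This
bounds `(e, y) = m - n`, the positive direction, and positivity of the norm then bounds all
coordinates. -/
theorem finite_lattice_cone_le {x : (ℝ × ℝ) × (ℝ × ℝ)} (hx : 0 < formL x x)
    (hwx : 0 < formL chamberPoint x) (c : ℝ) :
    {y | y ∈ latticeL ∧ 0 < formL y y ∧ 0 < formL chamberPoint y ∧ formL x y ≤ c}.Finite := by
  set e : (ℝ × ℝ) × (ℝ × ℝ) := ((0, 0), (1, -1)) with he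
  have hline : Continuous fun t : ℝ => x - t • e := by fun_prop
  have hev : ∀ᶠ t : ℝ in nhds 0, 0 < formL (x - t • e) (x - t • e) ∧
      0 < formL chamberPoint (x - t • e) :=
    (((continuous_formL hline hline).tendsto' 0 (formL x x) (by simp)).eventually_const_lt hx).and
      (((continuous_formL continuous_const hline).tendsto' 0 (formL chamberPoint x)
        (by simp)).eventually_const_lt hwx)
  obtain ⟨ε, ⟨h1, h2⟩, hε⟩ :=
    ((hev.filter_mono nhdsWithin_le_nhds).and (self_mem_nhdsWithin (s := Set.Ioi 0))).exists
  have hε' : (0 : ℝ) < ε := hε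
  obtain ⟨N, hN⟩ := exists_nat_ge (c / ε)
  have hfin := ((Set.finite_Icc (-(N : ℤ)) N).prod ((Set.finite_Icc (-(N : ℤ)) N).prod
    ((Set.finite_Icc (-(N : ℤ)) N).prod (Set.finite_Icc (-(N : ℤ)) N)))).image
      fun p => latVec p.1 p.2.1 p.2.2.1 p.2.2.2
  refine hfin.subset ?_
  rintro y ⟨hy, hyy, hwy, hxy⟩
  have h3 := formL_pos_of_same_cone h1 hyy h2 hwy
  have h4 : 0 < formL e y := formL_pos_of_same_cone (by simp [he, formL_apply]) hyy
    (by simp [he, formL_apply, chamberPoint, listedWeylVector]; norm_num) hwy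
  obtain ⟨i, j, m, n, rfl⟩ := mem_latticeL_iff.1 hy
  rw [map_sub, map_smul, LinearMap.sub_apply, LinearMap.smul_apply, smul_eq_mul] at h3
  have h5 : formL e (latVec i j m n) = ((m - n : ℤ) : ℝ) := by
    simp [he, formL_apply, latVec]
    ring
  have h6 : formL e (latVec i j m n) ≤ N := by
    refine le_trans ?_ hN
    rw [le_div_iff₀ hε']
    linarith
  rw [h5] at h4 h6
  have h4' : 0 < m - n := by exact_mod_cast h4
  have h6' : m - n ≤ N := by exact_mod_cast h6
  rw [formL_latVec] at hyy
  have hyy' : 0 < -(2 * i * i + i * j + j * i + 4 * j * j) - m * n - n * m := by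
    exact_mod_cast hyy
  have k1 : 2 * ((m + n) * (m + n)) + 7 * (i * i) + (i + 4 * j) * (i + 4 * j) <
      2 * ((m - n) * (m - n)) := by linarith
  have a1 := mul_self_nonneg (m + n)
  have a2 := mul_self_nonneg i
  have a3 := mul_self_nonneg (i + 4 * j)
  have b1 := abs_le_of_sq_le_sq' (a := m + n) (b := m - n) (by linarith) h4'.le
  have b2 := abs_le_of_sq_le_sq' (a := i) (b := m - n) (by linarith) h4'.le
  have b3 := abs_le_of_sq_le_sq' (a := i + 4 * j) (b := 2 * (m - n)) (by linarith) (by linarith)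
  refine ⟨(i, j, m, n), ⟨⟨?_, ?_⟩, ⟨?_, ?_⟩, ⟨?_, ?_⟩, ?_, ?_⟩, rfl⟩ <;> dsimp only <;> omega

/-- Choose `g` minimising `(x, g w)` over the orbit of `w = chamberPoint`. Comparison with `g sᵢ w =
g w + g αᵢ` gives `(g⁻¹ x, αᵢ) ≥ 0`, strictly because `x` is regular. -/
theorem exists_map_mem_fundamentalChamber {x : (ℝ × ℝ) × (ℝ × ℝ)}
    (hx : x ∈ regularVectors formL latticeL) (hwx : 0 < formL chamberPoint x) :
    ∃ g ∈ reflectionGroup formL latticeL, g x ∈ fundamentalChamber := by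
  set T := {y | (∃ g ∈ reflectionGroup formL latticeL, y = g chamberPoint) ∧
    formL x y ≤ formL x chamberPoint} with hT
  have hTfin : T.Finite := by
    refine (finite_lattice_cone_le hx.1 hwx (formL x chamberPoint)).subset ?_
    rintro _ ⟨⟨g, hg, rfl⟩, hle⟩
    have hw : 0 < formL chamberPoint chamberPoint := by rw [chamberPoint_norm]; norm_num
    have hg' := reflectionGroup_le_autGroupPlus hg
    exact ⟨(hg'.1.2 _).2 chamberPoint_mem, by rwa [hg'.1.1],
      formL_chamberPoint_pos_of_joinedIn (hg'.2 _ hw) hw, hle⟩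
  obtain ⟨_, ⟨⟨g, hg, rfl⟩, hle⟩, hmin⟩ := Set.exists_min_image T (formL x) hTfin
    ⟨chamberPoint, ⟨1, one_mem _, rfl⟩, le_rfl⟩
  have hg' := (reflectionGroup_le_autGroupPlus hg).1
  have hz := map_mem_regularVectors (inv_mem hg') hx
  refine ⟨g⁻¹, inv_mem hg, fun i => lt_of_le_of_ne ?_ (hz.2 _ (isRoot_listedRoot i)).symm⟩
  have hα := isRoot_listedRoot i
  have hs := reflectionEquiv_mem_reflectionGroup hα
  have hsw : reflectionEquiv formL (listedRoot i) hα.2.2.1.ne chamberPoint =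
      chamberPoint + listedRoot i := by
    rw [reflectionEquiv_apply, formL_chamberPoint_listedRoot, mul_div_cancel₀ _ two_ne_zero,
      neg_div, div_self hα.2.2.1.ne, neg_one_smul, sub_neg_eq_add]
  have hle' : formL x (g chamberPoint) ≤ formL x (g (chamberPoint + listedRoot i)) := by
    rcases le_or_gt (formL x (g (chamberPoint + listedRoot i))) (formL x chamberPoint) with h | h
    · refine hmin _ ⟨⟨_, mul_mem hg hs, ?_⟩, h⟩
      rw [LinearEquiv.mul_apply, hsw]
    · exact hle.trans h.le
  rw [map_add, map_add] at hle'
  rw [← hg'.1, show g (g⁻¹ x) = x from g.apply_symm_apply x]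
  linarith

theorem exists_image_fundamentalChamber {D : Set ((ℝ × ℝ) × (ℝ × ℝ))}
    (hD : IsWeylChamber formL latticeL D) :
    ∃ g ∈ autGroup formL latticeL, D = g '' fundamentalChamber := by
  obtain ⟨x, hx, rfl⟩ := hD
  obtain ⟨g, hg, hgx⟩ : ∃ g ∈ autGroup formL latticeL, g x ∈ fundamentalChamber := by
    rcases (formL_chamberPoint_ne_zero_of_norm_pos hx.1).lt_or_gt with h | h
    · have hneg : LinearEquiv.neg ℝ ∈ autGroup formL latticeL :=
        ⟨fun x y => by simp, fun x => by simp⟩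
      obtain ⟨g, hg, hgx⟩ := exists_map_mem_fundamentalChamber (map_mem_regularVectors hneg hx)
        (by simpa using h)
      exact ⟨g * LinearEquiv.neg ℝ, mul_mem (reflectionGroup_le_autGroupPlus hg).1 hneg, hgx⟩
    · obtain ⟨g, hg, hgx⟩ := exists_map_mem_fundamentalChamber hx h
      exact ⟨g, (reflectionGroup_le_autGroupPlus hg).1, hgx⟩
  refine ⟨g⁻¹, inv_mem hg, ?_⟩
  rw [← connectedComponentIn_eq_fundamentalChamber hgx,
    image_connectedComponentIn_regularVectors (inv_mem hg) (map_mem_regularVectors hg hx)]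
  congr 1
  exact (g.symm_apply_apply x).symm

/-! ### The Gram matrix and the diagram symmetry -/

/-- The Gram matrix of the listed roots. -/
def listedGram : Matrix (Fin 6) (Fin 6) ℤ :=
  !![-2, 0, 0, 2, 1, 0;
     0, -14, 0, 0, 7, 14;
     0, 0, -2, 1, 0, 7;
     2, 0, 1, -2, 0, 0;
     1, 7, 0, 0, -2, 0;
     0, 14, 7, 0, 0, -14]

theorem formL_listedRoot (i j : Fin 6) :
    formL (listedRoot i) (listedRoot j) = listedGram i j := by
  rw [listedRoot_eq, listedRoot_eq]
  fin_cases i <;> fin_cases j <;> exact (formL_latVec ..).trans (congrArg _ (by decide))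

theorem hasBond_listedRoot (i j : Fin 6) (h : i ≠ j) :
    HasBond formL (listedRoot i) (listedRoot j) (dynkinDiagramL i j) := by
  simp only [HasBond, formL_listedRoot]
  revert h
  fin_cases i <;> fin_cases j <;> simp [listedGram, dynkinDiagramL] <;> norm_num

theorem injective_listedRoot : Function.Injective listedRoot := by
  intro i j h
  have h1 : ∀ k, listedGram i k = listedGram j k := fun k => by
    have := formL_listedRoot i k
    rw [h, formL_listedRoot] at this
    exact_mod_cast this.symm
  exact (by decide : ∀ i j, listedGram i 0 = listedGram j 0 →
    listedGram i 1 = listedGram j 1 → i = j) i j (h1 0) (h1 1)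

/-- The automorphism of `L` that induces the symmetry of the Dynkin diagram. -/
noncomputable def diagramAut : ((ℝ × ℝ) × (ℝ × ℝ)) ≃ₗ[ℝ] ((ℝ × ℝ) × (ℝ × ℝ)) :=
  LinearEquiv.ofInvolutive
    { toFun := fun x => ((-x.1.1 - 2 * x.2.1, -x.1.2), (x.2.1, x.2.2 - 2 * x.2.1 - 2 * x.1.1))
      map_add' := fun x y => by ext <;> simp <;> ring
      map_smul' := fun c x => by ext <;> simp <;> ring }
    (fun x => by ext <;> simp; ring)

theorem diagramAut_apply (x : (ℝ × ℝ) × (ℝ × ℝ)) : diagramAut x =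
    ((-x.1.1 - 2 * x.2.1, -x.1.2), (x.2.1, x.2.2 - 2 * x.2.1 - 2 * x.1.1)) := rfl

theorem diagramAut_listedRoot (i : Fin 6) :
    diagramAut (listedRoot i) = listedRoot (![3, 5, 4, 0, 2, 1] i) := by
  fin_cases i <;> ext <;> simp [diagramAut_apply, listedRoot] <;> norm_num

theorem diagramAut_mem_autGroup : diagramAut ∈ autGroup formL latticeL := by
  have hL : ∀ x ∈ latticeL, diagramAut x ∈ latticeL := by
    intro x hx
    obtain ⟨i, j, m, n, rfl⟩ := mem_latticeL_iff.1 hx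
    refine mem_latticeL_iff.2 ⟨-i, -j - m, m, n - 2 * m - i - 4 * j, ?_⟩
    ext <;> simp [diagramAut_apply, latVec] <;> ring
  refine ⟨fun x y => ?_, fun x => ⟨fun h => ?_, hL x⟩⟩
  · simp only [diagramAut_apply, formL_apply]
    ring
  · have := hL _ h
    rwa [show diagramAut (diagramAut x) = x from diagramAut.symm_apply_apply x] at this

theorem diagramAut_mem_autGroupPlus : diagramAut ∈ autGroupPlus formL latticeL := by
  refine ⟨diagramAut_mem_autGroup, fun x hx => ?_⟩
  have hσx : 0 < formL (diagramAut x) (diagramAut x) := by rwa [diagramAut_mem_autGroup.1]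
  have hw : formL chamberPoint (diagramAut x) = formL chamberPoint x := by
    simp only [diagramAut_apply, formL_apply, chamberPoint, listedWeylVector]
    simp
    ring
  refine joinedIn_of_same_cone hx hσx ?_
  rcases (formL_chamberPoint_ne_zero_of_norm_pos hx).lt_or_gt with h | h
  · have := formL_pos_of_same_cone (x := -x) (y := -diagramAut x) (by simpa using hx)
      (by simpa using hσx) (by simpa using h) (by simpa [hw] using h)
    simpa using this
  · exact formL_pos_of_same_cone hx hσx h (by rwa [hw])

/-! ### Reduction modulo 2: the diagram symmetry is not in the reflection group -/

/-- One of the two anisotropic planes into which the quadratic space `L / 2 L` decomposes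
canonically; to be precise, its preimage in `L`. -/
def anisotropicPlane : Set ((ℝ × ℝ) × (ℝ × ℝ)) :=
  {x | ∃ i j m n : ℤ, x = latVec i j m n ∧ Even j ∧ Even (i + m + n)}

/-- Modulo `2` a root is anisotropic, so it lies in this plane or in its orthogonal complement. Its
reflection is the transvection `x + (x, α) α`, which preserves the plane in either case. -/
theorem even_coords_of_reflection {i j m n i' j' m' n' r : ℤ}
    (e1 : Odd (i * i + i * j + 2 * (j * j) + m * n))
    (e2 : Even r ↔ Even (-(2 * i' * i + i' * j + j' * i + 4 * j' * j) - m' * n - n' * m))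
    (hj : Even j') (hs : Even (i' + m' + n')) :
    Even (j' + r * j) ∧ Even (i' + r * i + (m' + r * m) + (n' + r * n)) := by
  have h4 : Even (4 : ℤ) := by decide
  rw [← Int.not_even_iff_odd] at e1
  simp only [Int.even_add, Int.even_sub, even_neg, Int.even_mul, even_two, h4, hj, true_or,
    true_iff, iff_true, or_self] at e1 e2 hs ⊢
  by_cases hm : Even m <;> by_cases hn : Even n <;> by_cases hi : Even i <;>
    by_cases hj : Even j <;> by_cases hm' : Even m' <;> by_cases hn' : Even n' <;>
    simp_all [-Int.not_even_iff_odd]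

theorem reflection_mem_anisotropicPlane {α x : (ℝ × ℝ) × (ℝ × ℝ)}
    (hα : IsRoot formL latticeL α) (hx : x ∈ anisotropicPlane) :
    x - (2 * formL x α / formL α α) • α ∈ anisotropicPlane := by
  obtain ⟨d, hd, hn, hdvd⟩ := root_cases hα
  obtain ⟨i', j', m', n', rfl, hj, hs⟩ := hx
  obtain ⟨r, hr⟩ := hdvd _ (latVec_mem i' j' m' n')
  obtain ⟨i, j, m, n, rfl⟩ := mem_latticeL_iff.1 hα.1
  have hdR : (d : ℝ) ≠ 0 := by rcases hd with rfl | rfl <;> norm_num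
  have hc : 2 * formL (latVec i' j' m' n') (latVec i j m n) /
      formL (latVec i j m n) (latVec i j m n) = -r := by
    rw [hr, hn]
    field_simp
  rw [hc]
  refine ⟨i' + r * i, j' + r * j, m' + r * m, n' + r * n, ?_, ?_⟩
  · ext <;> simp [latVec] <;> ring
  rw [formL_latVec] at hn hr
  have hn' : i * i + i * j + 2 * (j * j) + m * n = d := by
    have : -(2 * i * i + i * j + j * i + 4 * j * j) - m * n - n * m = -2 * d := by
      exact_mod_cast hn
    linarith
  have hr' : d * r = -(2 * i' * i + i' * j + j' * i + 4 * j' * j) - m' * n - n' * m := by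
    exact_mod_cast hr.symm
  have hdo : Odd d := by rcases hd with rfl | rfl <;> decide
  have e1 : Odd (i * i + i * j + 2 * (j * j) + m * n) := hn' ▸ hdo
  have e2 : Even r ↔ Even (-(2 * i' * i + i' * j + j' * i + 4 * j' * j) - m' * n - n' * m) := by
    rw [← hr', Int.even_mul]
    simp [Int.not_even_iff_odd.2 hdo]
  exact even_coords_of_reflection e1 e2 hj hs

theorem map_mem_anisotropicPlane_iff
    {g : ((ℝ × ℝ) × (ℝ × ℝ)) ≃ₗ[ℝ] ((ℝ × ℝ) × (ℝ × ℝ))}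
    (hg : g ∈ reflectionGroup formL latticeL) :
    ∀ x, g x ∈ anisotropicPlane ↔ x ∈ anisotropicPlane := by
  induction hg using Subgroup.closure_induction with
  | mem s hs =>
    obtain ⟨α, hα, hs⟩ := hs
    have h1 : ∀ x ∈ anisotropicPlane, s x ∈ anisotropicPlane := fun x hx =>
      hs x ▸ reflection_mem_anisotropicPlane hα hx
    refine fun x => ⟨fun h => ?_, h1 x⟩
    have hss : s (s x) = x := by
      have : s = reflectionEquiv formL α hα.2.2.1.ne := by
        ext x : 1
        rw [hs, reflectionEquiv_apply]
      rw [this]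
      exact (reflectionEquiv formL α hα.2.2.1.ne).symm_apply_apply x
    exact hss ▸ h1 _ h
  | one => exact fun x => Iff.rfl
  | mul g h _ _ hg hh => exact fun x => (hg (h x)).trans (hh x)
  | inv g _ hg =>
    intro x
    rw [← hg, show g (g⁻¹ x) = x from g.apply_symm_apply x]

theorem diagramAut_notMem_reflectionGroup : diagramAut ∉ reflectionGroup formL latticeL := by
  intro h
  -- The witness is `α₃`, which lies in the plane; its image `α₅` has `j = -1` and does not.
  have h1 := (map_mem_anisotropicPlane_iff h (latVec 0 0 1 1)).2
    ⟨0, 0, 1, 1, rfl, by decide, by decide⟩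
  obtain ⟨i, j, m, n, h2, ⟨k, hk⟩, -⟩ := h1
  have e1 := congrArg (fun x => x.1.1) h2
  have e2 := congrArg (fun x => x.1.2) h2
  simp only [diagramAut_apply, latVec] at e1 e2
  have e3 : (j : ℝ) = -1 := by
    push_cast at e1 e2
    linarith
  have e4 : j = -1 := by exact_mod_cast e3
  omega

/-! ### Automorphisms permuting the simple roots, and the index -/

/-- A vector is determined by its coordinates with respect to four of the listed roots. -/
theorem eq_combination (x : (ℝ × ℝ) × (ℝ × ℝ)) : x =
    ((x.1.1 + 7 * x.1.2) / 4 + (x.2.1 - x.2.2)) • listedRoot 0 +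
      ((x.1.1 - x.1.2) / 4) • listedRoot 1 + x.2.1 • listedRoot 2 +
      (x.2.1 - x.2.2) • listedRoot 3 := by
  ext <;> simp [listedRoot] <;> ring

section Permutation

variable {h : ((ℝ × ℝ) × (ℝ × ℝ)) ≃ₗ[ℝ] ((ℝ × ℝ) × (ℝ × ℝ))}

/-- From `α₂` the fixed roots propagate along the hexagon through `α₅`, `α₁`, `α₄`, `α₃`, each being
the only listed root with its product with the previous one. Four of these span. -/
theorem eq_one_of_fix (hh : h ∈ autGroup formL latticeL)
    (hperm : ∀ i, ∃ j, h (listedRoot i) = listedRoot j) (h1 : h (listedRoot 1) = listedRoot 1) :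
    h = 1 := by
  have fix : ∀ a b : Fin 6, (∀ j, listedGram j a = listedGram b a → j = b) →
      h (listedRoot a) = listedRoot a → h (listedRoot b) = listedRoot b := by
    intro a b hab ha
    obtain ⟨j, hj⟩ := hperm b
    have := hh.1 (listedRoot b) (listedRoot a)
    rw [ha, hj, formL_listedRoot, formL_listedRoot] at this
    rw [hj, hab j (by exact_mod_cast this)]
  have h4 := fix 1 4 (by decide) h1
  have h0 := fix 4 0 (by decide) h4
  have h3 := fix 0 3 (by decide) h0
  have h2 := fix 3 2 (by decide) h3
  ext x : 1
  rw [eq_combination x]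
  simp only [map_add, map_smul, h0, h1, h2, h3]
  rfl

/-- Only `α₂` and `α₆` have norm `-14`, so `h` fixes `α₂` or sends it to `α₆`, which `diagramAut`
sends back. -/
theorem eq_one_or_mul_diagramAut_eq_one (hh : h ∈ autGroup formL latticeL)
    (hperm : ∀ i, ∃ j, h (listedRoot i) = listedRoot j) : h = 1 ∨ h * diagramAut = 1 := by
  obtain ⟨j, hj⟩ := hperm 1
  have hn := hh.1 (listedRoot 1) (listedRoot 1)
  rw [hj, formL_listedRoot, formL_listedRoot] at hn
  have hn' : listedGram j j = listedGram 1 1 := by exact_mod_cast hn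
  have hj' : j = 1 ∨ j = 5 := by
    revert hn'
    clear hn hj
    revert j
    decide
  rcases hj' with rfl | rfl
  · exact Or.inl (eq_one_of_fix hh hperm hj)
  · right
    rw [mul_eq_one_comm]
    refine eq_one_of_fix (mul_mem diagramAut_mem_autGroup hh) (fun i => ?_) ?_
    · obtain ⟨k, hk⟩ := hperm i
      exact ⟨_, by rw [LinearEquiv.mul_apply, hk, diagramAut_listedRoot]⟩
    · rw [LinearEquiv.mul_apply, hj, diagramAut_listedRoot]
      rfl

end Permutation

theorem relIndex_reflectionGroup :
    (reflectionGroup formL latticeL).relIndex (autGroupPlus formL latticeL) = 2 := by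
  rw [Subgroup.relIndex_eq_two_iff_exists_notMem_and]
  refine ⟨diagramAut, diagramAut_mem_autGroupPlus, diagramAut_notMem_reflectionGroup,
    fun g hg => ?_⟩
  have hw : 0 < formL chamberPoint chamberPoint := by rw [chamberPoint_norm]; norm_num
  have hreg := fundamentalChamber_subset chamberPoint_mem_fundamentalChamber
  -- After correction by `w ∈ W` the automorphism `w * g` stabilises the fundamental chamber, hence
  -- permutes its simple roots.
  obtain ⟨w, hwmem, hgw⟩ := exists_map_mem_fundamentalChamber (map_mem_regularVectors hg.1 hreg)
    (formL_chamberPoint_pos_of_joinedIn (hg.2 _ hw) hw)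
  have hh : w * g ∈ autGroup formL latticeL :=
    mul_mem (reflectionGroup_le_autGroupPlus hwmem).1 hg.1
  have himage : (w * g) '' fundamentalChamber = fundamentalChamber := by
    have := image_connectedComponentIn_regularVectors hh hreg
    rwa [connectedComponentIn_eq_fundamentalChamber chamberPoint_mem_fundamentalChamber,
      connectedComponentIn_eq_fundamentalChamber (x := (w * g) chamberPoint) hgw] at this
  have hroots := simpleRoots_image hh fundamentalChamber
  rw [himage, simpleRoots_fundamentalChamber] at hroots
  have hperm : ∀ i, ∃ j, (w * g) (listedRoot i) = listedRoot j := fun i => by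
    have : (w * g) (listedRoot i) ∈ Set.range listedRoot :=
      hroots ▸ ⟨_, ⟨i, rfl⟩, rfl⟩
    obtain ⟨j, hj⟩ := this
    exact ⟨j, hj.symm⟩
  rcases eq_one_or_mul_diagramAut_eq_one hh hperm with h | h
  · exact Or.inr (eq_inv_of_mul_eq_one_right h ▸ inv_mem hwmem)
  · rw [mul_assoc] at h
    exact Or.inl (eq_inv_of_mul_eq_one_right h ▸ inv_mem hwmem)

theorem listedWeylVector_mem : listedWeylVector ∈ latticeL := by
  have := latticeL.neg_mem chamberPoint_mem
  rwa [chamberPoint, neg_neg] at this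

theorem listedWeylVector_norm : formL listedWeylVector listedWeylVector = 8 := by
  simpa [chamberPoint] using chamberPoint_norm

theorem isWeylVector_listedWeylVector :
    IsWeylVector formL latticeL fundamentalChamber listedWeylVector := by
  intro α hα
  rw [simpleRoots_fundamentalChamber, range_listedRoot_eq] at hα
  exact hα.2

end LorentzLattice

theorem mainTheorem10 :
    -- `L` has six simple roots and a Weyl vector of norm `8` (for any choice of Weyl chamber)
    (∀ D, LorentzLattice.IsWeylChamber LorentzLattice.formL LorentzLattice.latticeL D →
      (LorentzLattice.simpleRoots LorentzLattice.formL LorentzLattice.latticeL D).ncard = 6 ∧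
      ∃ ρ ∈ LorentzLattice.latticeL,
        LorentzLattice.IsWeylVector LorentzLattice.formL LorentzLattice.latticeL D ρ ∧
        LorentzLattice.formL ρ ρ = 8) ∧
    -- for one choice of Weyl chamber they are the listed roots and the listed Weyl vector
    (∃ D, LorentzLattice.IsWeylChamber LorentzLattice.formL LorentzLattice.latticeL D ∧
      LorentzLattice.simpleRoots LorentzLattice.formL LorentzLattice.latticeL D =
        Set.range LorentzLattice.listedRoot ∧
      LorentzLattice.IsWeylVector LorentzLattice.formL LorentzLattice.latticeL D
        LorentzLattice.listedWeylVector) ∧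
    -- the listed simple roots are exactly the roots `α` with `(ρ, α) = α² / 2`
    Set.range LorentzLattice.listedRoot =
      {α | LorentzLattice.IsRoot LorentzLattice.formL LorentzLattice.latticeL α ∧
        LorentzLattice.formL LorentzLattice.listedWeylVector α = LorentzLattice.formL α α / 2} ∧
    -- the norms of the listed vectors
    (∀ i, LorentzLattice.formL (LorentzLattice.listedRoot i) (LorentzLattice.listedRoot i) =
      (![-2, -14, -2, -2, -2, -14] : Fin 6 → ℝ) i) ∧
    LorentzLattice.formL LorentzLattice.listedWeylVector LorentzLattice.listedWeylVector = 8 ∧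
    -- the reflection group has index `2` in `Aut(L)⁺`
    LorentzLattice.reflectionGroup LorentzLattice.formL LorentzLattice.latticeL ≤
      LorentzLattice.autGroupPlus LorentzLattice.formL LorentzLattice.latticeL ∧
    (LorentzLattice.reflectionGroup LorentzLattice.formL LorentzLattice.latticeL).relIndex
      (LorentzLattice.autGroupPlus LorentzLattice.formL LorentzLattice.latticeL) = 2 ∧
    -- the Dynkin diagram
    (∀ i j, i ≠ j →
      LorentzLattice.HasBond LorentzLattice.formL (LorentzLattice.listedRoot i)
        (LorentzLattice.listedRoot j) (LorentzLattice.dynkinDiagramL i j)) := by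
  open LorentzLattice in
  refine ⟨fun D hD => ?_, ⟨fundamentalChamber, isWeylChamber_fundamentalChamber,
    simpleRoots_fundamentalChamber, isWeylVector_listedWeylVector⟩, range_listedRoot_eq,
    formL_listedRoot_self, listedWeylVector_norm, reflectionGroup_le_autGroupPlus,
    relIndex_reflectionGroup, hasBond_listedRoot⟩
  obtain ⟨g, hg, rfl⟩ := exists_image_fundamentalChamber hD
  have hroots := simpleRoots_image hg fundamentalChamber
  refine ⟨?_, g listedWeylVector, (hg.2 _).2 listedWeylVector_mem, ?_, ?_⟩
  · rw [hroots, Set.ncard_image_of_injective _ g.injective, simpleRoots_fundamentalChamber,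
      ← Nat.card_coe_set_eq, Nat.card_range_of_injective injective_listedRoot, Nat.card_fin]
  · rw [IsWeylVector, hroots]
    rintro _ ⟨α, hα, rfl⟩
    rw [hg.1, hg.1]
    exact isWeylVector_listedWeylVector α hα
  · rw [hg.1, listedWeylVector_norm]
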